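/- Let $F$ be a field and $\Gamma=(V,E,s,r)$ a finite directed graph, with Leavitt path algebra $L(\Gamma)$ over $F$, graded by $\deg v=0$, $\deg e=1$, $\deg e^*=-1$; let $L(\Gamma)_i$ be its component of degree $i$. A nonempty set $W\subseteq V$ is hereditary if it contains every vertex that can be reached by a directed path from a vertex of $W$; let $W_1,\dots,W_k$ be the minimal hereditary sets. A specialization $\gamma$ assigns to every vertex $v$ that is not a sink an edge $\gamma(v)$ with $s(\gamma(v))=v$; the edges in the image of $\gamma$ are called special. Fix a specialization $\gamma$ such that only finitely many paths $e_1\cdots e_n$, $n\ge 1$, consist of special edges with $s(e_1),\dots,s(e_n)\notin W_1\cup\dots\cup W_k$. For a path $p$ let $l(p)$ be its length and $sd(p)$ the length of its longest final segment consisting of special edges. For $n,s,d\ge 0$ let $V_{n,s,d}$ be the span of all products $pq^*$ of paths $p,q$ with $l(p)+l(q)\ge n$, $sd(p)+sd(q)\le s$, $|l(p)-l(q)|\le d$, and let $V_k=\sum\{V_{n,s,d}\mid n\ge k(s+d+1)\}$ for $k\ge 1$. The $V_k$ are a basis of neighbourhoods of $0$ for an algebra topology on $L(\Gamma)$. In the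 completion $\overline{L(\Gamma)}$ let $\overline{L(\Gamma)_i}$ be the closure of $L(\Gamma)_i$, and let $\widehat L(\Gamma)=\sum_{i\in\mathbb Z}\overline{L(\Gamma)_i}$, a graded topological algebra. For $v\in V$ let $g_v(0)=v$, and let $g_v(n+1)=g_v(n)\gamma(r(g_v(n)))$ if $r(g_v(n))$ is not a sink, $g_v(n+1)=g_v(n)$ otherwise. Then for every $v$ the sequence $g_v(n)g_v(n)^*$ converges in $\widehat L(\Gamma)$ to an idempotent $e_v$. Let $V=S_1\,\dot\cup\cdots\dot\cup\, S_m$ be the connected components of the undirected graph with vertex set $V$ whose edges are the special edges without their directions, and let $J_i$ be the closed two-sided ideal of $\widehat L(\Gamma)$ generated by the $e_v$, $v\in S_i$. For a minimal hereditary set $W$ let $I(W)$ be the closed two-sided ideal of $\widehat L(\Gamma)$ generated by the vertices in $W$. Then: 1. $\widehat L(\Gamma)=J_1\oplus\cdots\oplus J_m$; 2. each $J_i$ is topologically graded simple: it is a graded ideal with $J_i^2\ne 0$, and $0$ and $J_i$ are the only closed graded two-sided ideals of the algebra $J_i$; 3. for every minimal hereditary set $W_i$, $I(W_i)=\bigoplus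 J_j$, the sum over all $j$ with $S_j\cap W_i\neq\emptyset$. -/

import Mathlib

open Filter Topology

noncomputable section

/-- A directed graph with vertex set `V` and edge set `E` (loops and parallel edges allowed). -/
structure DirGraph (V E : Type*) where
  /-- source of an edge -/
  s : E → V
  /-- range of an edge -/
  r : E → V

namespace DirGraph

/-- The edges `l` form a path that starts at `v`; the empty list is the path of length `0` at `v`. -/
def IsPathFrom {V E : Type*} (Γ : DirGraph V E) : V → List E → Prop
  | _, [] => True
  | v, e :: l => Γ.s e = v ∧ Γ.IsPathFrom (Γ.r e) l

/-- The end of the path that starts at `v` and runs through the edges `l`. -/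
def endFrom {V E : Type*} (Γ : DirGraph V E) : V → List E → V
  | v, [] => v
  | _, e :: l => Γ.endFrom (Γ.r e) l

theorem isPathFrom_append {V E : Type*} (Γ : DirGraph V E) (v : V) (l t : List E) :
    Γ.IsPathFrom v (l ++ t) ↔ Γ.IsPathFrom v l ∧ Γ.IsPathFrom (Γ.endFrom v l) t := by
  induction l generalizing v with
  | nil => simp [IsPathFrom, endFrom]
  | cons e l ih => simp [IsPathFrom, endFrom, ih, and_assoc]

theorem endFrom_append {V E : Type*} (Γ : DirGraph V E) (v : V) (l t : List E) :
    Γ.endFrom v (l ++ t) = Γ.endFrom (Γ.endFrom v l) t := by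
  induction l generalizing v with
  | nil => simp [endFrom]
  | cons e l ih => simp [endFrom, ih]

/-- Paths of the graph: a starting vertex and a list of consecutive edges. -/
structure Path {V E : Type*} (Γ : DirGraph V E) where
  /-- the vertex at which the path starts -/
  src : V
  /-- the edges of the path, in order -/
  edges : List E
  isPath : Γ.IsPathFrom src edges

/-- The vertex `v` as a path of length `0`. -/
def Path.nil {V E : Type*} (Γ : DirGraph V E) (v : V) : Γ.Path := ⟨v, [], trivial⟩

/-- The end `r(p)` of a path `p`. -/
def Path.range {V E : Type*} {Γ : DirGraph V E} (p : Γ.Path) : V := Γ.endFrom p.src p.edges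

/-- The length of a path. -/
def Path.length {V E : Type*} {Γ : DirGraph V E} (p : Γ.Path) : ℕ := p.edges.length

/-- The path `pe`, for an edge `e` that starts at the end of `p`. -/
def Path.snoc {V E : Type*} {Γ : DirGraph V E} (p : Γ.Path) (e : E) (h : Γ.s e = p.range) :
    Γ.Path :=
  ⟨p.src, p.edges ++ [e], (Γ.isPathFrom_append _ _ _).2 ⟨p.isPath, h, trivial⟩⟩

/-- `w` is a descendant of `v`. -/
def IsDescendant {V E : Type*} (Γ : DirGraph V E) (v w : V) : Prop :=
  ∃ p : Γ.Path, p.src = v ∧ p.range = w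

/-- Hereditary sets of vertices: nonempty and containing the descendants of their elements. -/
def IsHereditary {V E : Type*} (Γ : DirGraph V E) (W : Set V) : Prop :=
  W.Nonempty ∧ ∀ w ∈ W, ∀ u, Γ.IsDescendant w u → u ∈ W

/-- Minimal hereditary sets of vertices. -/
def IsMinHereditary {V E : Type*} (Γ : DirGraph V E) (W : Set V) : Prop :=
  Minimal Γ.IsHereditary W

/-- The vertices which emit an edge, that is, which are not sinks. -/
def NonSink {V E : Type*} (Γ : DirGraph V E) (v : V) : Prop := ∃ e, Γ.s e = v

/-- A specialization chooses, for every vertex which is not a sink, an edge starting there. -/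
structure Specialization {V E : Type*} (Γ : DirGraph V E) where
  /-- the chosen edge -/
  edge : {v : V // Γ.NonSink v} → E
  s_edge : ∀ v, Γ.s (edge v) = v

namespace Specialization

/-- The special edges are the chosen ones. -/
def IsSpecial {V E : Type*} {Γ : DirGraph V E} (γ : Γ.Specialization) (e : E) : Prop :=
  e ∈ Set.range γ.edge

open Classical in
/-- The length of the longest final segment of `l` all of whose members are special edges. -/
def sd {V E : Type*} {Γ : DirGraph V E} (γ : Γ.Specialization) (l : List E) : ℕ :=
  (l.rtakeWhile (fun e => decide (γ.IsSpecial e))).length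

/-- The standing condition on specializations: only finitely many paths of positive length consist
of special edges all of which start outside the union of the minimal hereditary sets. -/
def Admissible {V E : Type*} {Γ : DirGraph V E} (γ : Γ.Specialization) : Prop :=
  {p : Γ.Path | p.edges ≠ [] ∧ ∀ e ∈ p.edges, γ.IsSpecial e ∧
    ∀ W : Set V, Γ.IsMinHereditary W → Γ.s e ∉ W}.Finite

open Classical in
/-- The special path `g_v(n)`: start at `v` and follow `n` special edges, but stop at a sink. -/
def specialPath {V E : Type*} {Γ : DirGraph V E} (γ : Γ.Specialization) (v : V) : ℕ → Γ.Path
  | 0 => Path.nil Γ v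
  | n + 1 =>
    if h : Γ.NonSink (γ.specialPath v n).range then
      (γ.specialPath v n).snoc (γ.edge ⟨_, h⟩) (γ.s_edge ⟨_, h⟩)
    else γ.specialPath v n

/-- The undirected graph on `V` whose edges are the special edges without their directions.
(Loops and multiplicities, which do not affect connectedness, are forgotten.) -/
def undirected {V E : Type*} {Γ : DirGraph V E} (γ : Γ.Specialization) : SimpleGraph V :=
  SimpleGraph.fromRel fun v w => ∃ e, γ.IsSpecial e ∧ Γ.s e = v ∧ Γ.r e = w

theorem sd_suffix_le {V E : Type*} {Γ : DirGraph V E} (γ : Γ.Specialization) (l t : List E) :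
    γ.sd t ≤ γ.sd (l ++ t) := by
  classical
  unfold sd List.rtakeWhile
  simp only [List.reverse_append, List.length_reverse, List.takeWhile_append]
  split_ifs with h
  · simp [h]
  · exact le_rfl

theorem sd_append_le {V E : Type*} {Γ : DirGraph V E} (γ : Γ.Specialization) (l t : List E) :
    γ.sd (l ++ t) ≤ γ.sd l + γ.sd t := by
  classical
  unfold sd List.rtakeWhile
  simp only [List.reverse_append, List.length_reverse, List.takeWhile_append]
  split_ifs with h
  · simp [h]; omega
  · omega

end Specialization

/-- Generators of the Leavitt path algebra: `v`, `e` and `e^*`. -/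
inductive Gen (V E : Type*)
  | vert (v : V)
  | edge (e : E)
  | ghost (e : E)

open Classical in
/-- Defining relations of the Leavitt path algebra of a finite graph. The relations `vert_vert`, …,
`sum_edge_ghost` make the sum of all vertices an identity element of the (a priori not unital)
algebra that they present; `one` says that it is the `1` of the free unital algebra used here. -/
inductive Rel (F : Type*) [Field F] {V E : Type*} [Fintype V] [Fintype E] (Γ : DirGraph V E) :
    FreeAlgebra F (Gen V E) → FreeAlgebra F (Gen V E) → Prop
  | vert_vert (v : V) :
      Rel F Γ (FreeAlgebra.ι F (Gen.vert v) * FreeAlgebra.ι F (Gen.vert v))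
        (FreeAlgebra.ι F (Gen.vert v))
  | vert_vert_ne (v w : V) (h : v ≠ w) :
      Rel F Γ (FreeAlgebra.ι F (Gen.vert v) * FreeAlgebra.ι F (Gen.vert w)) 0
  | source_edge (e : E) :
      Rel F Γ (FreeAlgebra.ι F (Gen.vert (Γ.s e)) * FreeAlgebra.ι F (Gen.edge e))
        (FreeAlgebra.ι F (Gen.edge e))
  | edge_range (e : E) :
      Rel F Γ (FreeAlgebra.ι F (Gen.edge e) * FreeAlgebra.ι F (Gen.vert (Γ.r e)))
        (FreeAlgebra.ι F (Gen.edge e))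
  | range_ghost (e : E) :
      Rel F Γ (FreeAlgebra.ι F (Gen.vert (Γ.r e)) * FreeAlgebra.ι F (Gen.ghost e))
        (FreeAlgebra.ι F (Gen.ghost e))
  | ghost_source (e : E) :
      Rel F Γ (FreeAlgebra.ι F (Gen.ghost e) * FreeAlgebra.ι F (Gen.vert (Γ.s e)))
        (FreeAlgebra.ι F (Gen.ghost e))
  | ghost_edge (e : E) :
      Rel F Γ (FreeAlgebra.ι F (Gen.ghost e) * FreeAlgebra.ι F (Gen.edge e))
        (FreeAlgebra.ι F (Gen.vert (Γ.r e)))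
  | ghost_edge_ne (e f : E) (h : e ≠ f) :
      Rel F Γ (FreeAlgebra.ι F (Gen.ghost e) * FreeAlgebra.ι F (Gen.edge f)) 0
  | sum_edge_ghost (v : V) (h : Γ.NonSink v) :
      Rel F Γ (FreeAlgebra.ι F (Gen.vert v))
        (∑ e with Γ.s e = v, FreeAlgebra.ι F (Gen.edge e) * FreeAlgebra.ι F (Gen.ghost e))
  | one : Rel F Γ (∑ v, FreeAlgebra.ι F (Gen.vert v)) 1

/-- The Leavitt path algebra `L(Γ)` over `F`. The specialization `γ` is not used in the algebra; it
is recorded in the type because the topology below depends on it. -/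
def Leavitt (F : Type*) [Field F] {V E : Type*} [Fintype V] [Fintype E] {Γ : DirGraph V E}
    (_γ : Γ.Specialization) : Type _ :=
  RingQuot (Rel F Γ)

namespace Leavitt

variable {F : Type*} [Field F] {V E : Type*} [Fintype V] [Fintype E] {Γ : DirGraph V E}

instance (γ : Γ.Specialization) : Ring (Leavitt F γ) :=
  inferInstanceAs (Ring (RingQuot (Rel F Γ)))

instance (γ : Γ.Specialization) : Algebra F (Leavitt F γ) :=
  inferInstanceAs (Algebra F (RingQuot (Rel F Γ)))

/-- The quotient map from the free algebra. -/
def quot (F : Type*) [Field F] {V E : Type*} [Fintype V] [Fintype E] {Γ : DirGraph V E}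
    (γ : Γ.Specialization) : FreeAlgebra F (Gen V E) →ₐ[F] Leavitt F γ :=
  RingQuot.mkAlgHom F (Rel F Γ)

/-- The vertex `v` in `L(Γ)`. -/
def vert (F : Type*) [Field F] {V E : Type*} [Fintype V] [Fintype E] {Γ : DirGraph V E}
    (γ : Γ.Specialization) (v : V) : Leavitt F γ := quot F γ (FreeAlgebra.ι F (Gen.vert v))

/-- The edge `e` in `L(Γ)`. -/
def edge (F : Type*) [Field F] {V E : Type*} [Fintype V] [Fintype E] {Γ : DirGraph V E}
    (γ : Γ.Specialization) (e : E) : Leavitt F γ := quot F γ (FreeAlgebra.ι F (Gen.edge e))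

/-- The element `e^*` of `L(Γ)`. -/
def ghost (F : Type*) [Field F] {V E : Type*} [Fintype V] [Fintype E] {Γ : DirGraph V E}
    (γ : Γ.Specialization) (e : E) : Leavitt F γ := quot F γ (FreeAlgebra.ι F (Gen.ghost e))

/-- The product `v e₁ ⋯ eₙ` in `L(Γ)`. -/
def listElt (F : Type*) [Field F] {V E : Type*} [Fintype V] [Fintype E] {Γ : DirGraph V E}
    (γ : Γ.Specialization) (v : V) (l : List E) : Leavitt F γ :=
  vert F γ v * (l.map (edge F γ)).prod

/-- The product `eₙ^* ⋯ e₁^* v` in `L(Γ)`. -/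
def listStar (F : Type*) [Field F] {V E : Type*} [Fintype V] [Fintype E] {Γ : DirGraph V E}
    (γ : Γ.Specialization) (v : V) (l : List E) : Leavitt F γ :=
  (l.reverse.map (ghost F γ)).prod * vert F γ v

/-- The element `p q^*` of `L(Γ)`, for paths `p` and `q`. -/
def mon (F : Type*) [Field F] {V E : Type*} [Fintype V] [Fintype E] {Γ : DirGraph V E}
    (γ : Γ.Specialization) (p q : Γ.Path) : Leavitt F γ :=
  listElt F γ p.src p.edges * listStar F γ q.src q.edges

section relations

variable (γ : Γ.Specialization)

theorem quot_rel {a b : FreeAlgebra F (Gen V E)} (h : Rel F Γ a b) : quot F γ a = quot F γ b :=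
  RingQuot.mkAlgHom_rel F h

theorem vert_vert (v : V) : vert F γ v * vert F γ v = vert F γ v := by
  simpa [vert] using quot_rel (F := F) γ (Rel.vert_vert v)

theorem vert_vert_ne {v w : V} (h : v ≠ w) : vert F γ v * vert F γ w = 0 := by
  simpa [vert] using quot_rel (F := F) γ (Rel.vert_vert_ne v w h)

theorem source_edge (e : E) : vert F γ (Γ.s e) * edge F γ e = edge F γ e := by
  simpa [vert, edge] using quot_rel (F := F) γ (Rel.source_edge e)

theorem edge_range (e : E) : edge F γ e * vert F γ (Γ.r e) = edge F γ e := by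
  simpa [vert, edge] using quot_rel (F := F) γ (Rel.edge_range e)

theorem range_ghost (e : E) : vert F γ (Γ.r e) * ghost F γ e = ghost F γ e := by
  simpa [vert, ghost] using quot_rel (F := F) γ (Rel.range_ghost e)

theorem ghost_source (e : E) : ghost F γ e * vert F γ (Γ.s e) = ghost F γ e := by
  simpa [vert, ghost] using quot_rel (F := F) γ (Rel.ghost_source e)

theorem ghost_edge (e : E) : ghost F γ e * edge F γ e = vert F γ (Γ.r e) := by
  simpa [vert, ghost, edge] using quot_rel (F := F) γ (Rel.ghost_edge e)

theorem ghost_edge_ne {e f : E} (h : e ≠ f) : ghost F γ e * edge F γ f = 0 := by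
  simpa [ghost, edge] using quot_rel (F := F) γ (Rel.ghost_edge_ne e f h)

theorem sum_vert : ∑ v, vert F γ v = 1 := by
  simpa [vert] using quot_rel (F := F) γ (Rel.one (Γ := Γ))

theorem listElt_cons (e : E) (l : List E) :
    listElt F γ (Γ.s e) (e :: l) = edge F γ e * listElt F γ (Γ.r e) l := by
  simp only [listElt, List.map_cons, List.prod_cons]
  rw [← mul_assoc, ← mul_assoc, source_edge, edge_range]

theorem listStar_cons (e : E) (l : List E) :
    listStar F γ (Γ.s e) (e :: l) = listStar F γ (Γ.r e) l * ghost F γ e := by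
  simp only [listStar, List.reverse_cons, List.map_append, List.prod_append, List.map_cons,
    List.map_nil, List.prod_cons, List.prod_nil, mul_one]
  rw [mul_assoc, mul_assoc, ghost_source, range_ghost]

theorem listElt_append (v : V) (l t : List E) (h : Γ.IsPathFrom v l) :
    listElt F γ v l * listElt F γ (Γ.endFrom v l) t = listElt F γ v (l ++ t) := by
  induction l generalizing v with
  | nil => simp [listElt, endFrom, ← mul_assoc, vert_vert]
  | cons e l ih =>
    obtain ⟨rfl, h⟩ := h
    rw [listElt_cons, mul_assoc, endFrom, ih _ h, List.cons_append, listElt_cons]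

theorem listStar_append (v : V) (l t : List E) (h : Γ.IsPathFrom v l) :
    listStar F γ (Γ.endFrom v l) t * listStar F γ v l = listStar F γ v (l ++ t) := by
  induction l generalizing v with
  | nil => simp [listStar, endFrom, mul_assoc, vert_vert]
  | cons e l ih =>
    obtain ⟨rfl, h⟩ := h
    rw [listStar_cons, ← mul_assoc, endFrom, ih _ h, List.cons_append, listStar_cons]

theorem listElt_mul_end (v : V) (l : List E) (h : Γ.IsPathFrom v l) :
    listElt F γ v l * vert F γ (Γ.endFrom v l) = listElt F γ v l := by
  simpa [listElt] using listElt_append (F := F) γ v l [] h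

theorem end_mul_listStar (v : V) (l : List E) (h : Γ.IsPathFrom v l) :
    vert F γ (Γ.endFrom v l) * listStar F γ v l = listStar F γ v l := by
  simpa [listStar] using listStar_append (F := F) γ v l [] h

theorem listStar_mul_listElt (v w : V) (l m : List E) (hl : Γ.IsPathFrom v l)
    (hm : Γ.IsPathFrom w m) :
    listStar F γ v l * listElt F γ w m = 0 ∨
    (v = w ∧ ∃ t, m = l ++ t ∧
      listStar F γ v l * listElt F γ w m = listElt F γ (Γ.endFrom v l) t) ∨
    (v = w ∧ ∃ t, l = m ++ t ∧
      listStar F γ v l * listElt F γ w m = listStar F γ (Γ.endFrom w m) t) := by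
  induction l generalizing v w m with
  | nil =>
    by_cases h : v = w
    · subst h
      exact Or.inr (Or.inl ⟨rfl, m, rfl, by
        simp [listElt, listStar, endFrom, ← mul_assoc, vert_vert]⟩)
    · left
      simp [listElt, listStar, ← mul_assoc, vert_vert_ne γ h]
  | cons e l ih =>
    cases m with
    | nil =>
      by_cases h : v = w
      · subst h
        exact Or.inr (Or.inr ⟨rfl, e :: l, rfl, by
          simp [listElt, listStar, endFrom, mul_assoc, vert_vert]⟩)
      · left
        simp [listElt, listStar, mul_assoc, vert_vert_ne γ h]
    | cons f m =>
      obtain ⟨rfl, hl⟩ := hl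
      obtain ⟨rfl, hm⟩ := hm
      rw [listStar_cons, listElt_cons, mul_assoc, ← mul_assoc (ghost F γ e)]
      by_cases h : e = f
      · subst h
        have hv : vert F γ (Γ.r e) * listElt F γ (Γ.r e) m = listElt F γ (Γ.r e) m := by
          simp [listElt, ← mul_assoc, vert_vert]
        rw [ghost_edge, hv]
        rcases ih (Γ.r e) (Γ.r e) m hl hm with h | ⟨-, t, rfl, h⟩ | ⟨-, t, rfl, h⟩
        · exact Or.inl h
        · exact Or.inr (Or.inl ⟨rfl, t, rfl, h⟩)
        · exact Or.inr (Or.inr ⟨rfl, t, rfl, h⟩)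
      · left
        rw [ghost_edge_ne γ h]; simp

/-- The product of `p₁ q₁^*` and `p₂ q₂^*` is zero or again of this form. -/
theorem mon_mul_mon (p₁ q₁ p₂ q₂ : Γ.Path) :
    mon F γ p₁ q₁ * mon F γ p₂ q₂ = 0 ∨
    ∃ p q : Γ.Path, mon F γ p₁ q₁ * mon F γ p₂ q₂ = mon F γ p q ∧
      (p.length : ℤ) - q.length = (p₁.length - q₁.length) + (p₂.length - q₂.length) ∧
      γ.sd p.edges + γ.sd q.edges ≤
        γ.sd p₁.edges + γ.sd q₁.edges + (γ.sd p₂.edges + γ.sd q₂.edges) ∧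
      p₁.length + q₂.length ≤ p.length + q.length := by
  obtain ⟨v₁, a₁, ha₁⟩ := p₁
  obtain ⟨w₁, b₁, hb₁⟩ := q₁
  obtain ⟨v₂, a₂, ha₂⟩ := p₂
  obtain ⟨w₂, b₂, hb₂⟩ := q₂
  have hassoc : mon F γ ⟨v₁, a₁, ha₁⟩ ⟨w₁, b₁, hb₁⟩ * mon F γ ⟨v₂, a₂, ha₂⟩ ⟨w₂, b₂, hb₂⟩ =
      listElt F γ v₁ a₁ * (listStar F γ w₁ b₁ * listElt F γ v₂ a₂) * listStar F γ w₂ b₂ := by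
    simp only [mon, mul_assoc]
  by_cases h1 : Γ.endFrom v₁ a₁ = Γ.endFrom w₁ b₁
  swap
  · left
    rw [hassoc, ← listElt_mul_end γ v₁ a₁ ha₁, ← end_mul_listStar γ w₁ b₁ hb₁]
    simp only [mul_assoc]
    rw [← mul_assoc (vert F γ (Γ.endFrom v₁ a₁)), vert_vert_ne γ h1]
    simp
  by_cases h2 : Γ.endFrom v₂ a₂ = Γ.endFrom w₂ b₂
  swap
  · left
    rw [hassoc, ← listElt_mul_end γ v₂ a₂ ha₂, ← end_mul_listStar γ w₂ b₂ hb₂]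
    simp only [mul_assoc]
    rw [← mul_assoc (vert F γ (Γ.endFrom v₂ a₂)), vert_vert_ne γ h2]
    simp
  rcases listStar_mul_listElt (F := F) γ w₁ v₂ b₁ a₂ hb₁ ha₂ with
    h | ⟨rfl, t, rfl, h⟩ | ⟨rfl, t, rfl, h⟩
  · left
    rw [hassoc, h]
    simp
  · right
    have ht := ((Γ.isPathFrom_append _ _ _).1 ha₂).2
    rw [← h1] at ht
    refine ⟨⟨v₁, a₁ ++ t, (Γ.isPathFrom_append _ _ _).2 ⟨ha₁, ht⟩⟩, ⟨w₂, b₂, hb₂⟩, ?_, ?_, ?_, ?_⟩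
    · rw [hassoc, h, ← h1, listElt_append γ _ _ _ ha₁, mon]
    · simp [Path.length]; omega
    · have e1 := γ.sd_append_le a₁ t
      have e2 := γ.sd_suffix_le b₁ t
      simp only
      omega
    · simp [Path.length]
  · right
    have ht := ((Γ.isPathFrom_append _ _ _).1 hb₁).2
    rw [h2] at ht
    refine ⟨⟨v₁, a₁, ha₁⟩, ⟨w₂, b₂ ++ t, (Γ.isPathFrom_append _ _ _).2 ⟨hb₂, ht⟩⟩, ?_, ?_, ?_, ?_⟩
    · rw [hassoc, h, h2, mul_assoc, listStar_append γ _ _ _ hb₂, mon]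
    · simp [Path.length]; omega
    · have e1 := γ.sd_append_le b₂ t
      have e2 := γ.sd_suffix_le a₂ t
      simp only
      omega
    · simp [Path.length]

theorem vert_eq_mon (v : V) : vert F γ v = mon F γ (Path.nil Γ v) (Path.nil Γ v) := by
  simp [mon, listElt, listStar, Path.nil, vert_vert]

theorem edge_eq_mon (e : E) :
    edge F γ e = mon F γ ⟨Γ.s e, [e], rfl, trivial⟩ (Path.nil Γ (Γ.r e)) := by
  simp [mon, listElt, listStar, Path.nil, source_edge, edge_range]

theorem ghost_eq_mon (e : E) :
    ghost F γ e = mon F γ (Path.nil Γ (Γ.r e)) ⟨Γ.s e, [e], rfl, trivial⟩ := by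
  simp [mon, listElt, listStar, Path.nil, ghost_source, range_ghost]

end relations

/-- The span `V_{n,s,d}` of the products `p q^*` with `l(p) + l(q) ≥ n`, `sd(p) + sd(q) ≤ s` and
`|l(p) - l(q)| ≤ d`. -/
def spanV (F : Type*) [Field F] {V E : Type*} [Fintype V] [Fintype E] {Γ : DirGraph V E}
    (γ : Γ.Specialization) (n s d : ℝ) : Submodule F (Leavitt F γ) :=
  Submodule.span F {x | ∃ p q : Γ.Path, x = mon F γ p q ∧ n ≤ p.length + q.length ∧
    (γ.sd p.edges : ℝ) + γ.sd q.edges ≤ s ∧ |(p.length : ℝ) - q.length| ≤ d}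

/-- The subspace `V_k`, the sum of the `V_{n,s,d}` with `n, s, d ≥ 0` and `n ≥ k(s + d + 1)`. -/
def nbhd (F : Type*) [Field F] {V E : Type*} [Fintype V] [Fintype E] {Γ : DirGraph V E}
    (γ : Γ.Specialization) (k : ℕ) : Submodule F (Leavitt F γ) :=
  ⨆ (n : ℝ) (s : ℝ) (d : ℝ) (_ : 0 ≤ n) (_ : 0 ≤ s) (_ : 0 ≤ d) (_ : k * (s + d + 1) ≤ n),
    spanV F γ n s d

/-- The homogeneous component `L(Γ)_i`, spanned by the products `p q^*` of degree
`l(p) - l(q) = i`. -/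
def component (F : Type*) [Field F] {V E : Type*} [Fintype V] [Fintype E] {Γ : DirGraph V E}
    (γ : Γ.Specialization) (i : ℤ) : Submodule F (Leavitt F γ) :=
  Submodule.span F {x | ∃ p q : Γ.Path, x = mon F γ p q ∧ (p.length : ℤ) - q.length = i}

section topology

variable (γ : Γ.Specialization)

theorem nbhd_eq_span (k : ℕ) : nbhd F γ k = Submodule.span F {x | ∃ p q : Γ.Path, x = mon F γ p q ∧
    (k : ℝ) * ((γ.sd p.edges : ℝ) + γ.sd q.edges + |(p.length : ℝ) - q.length| + 1) ≤
      p.length + q.length} := by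
  apply le_antisymm
  · refine iSup_le fun n => iSup_le fun s => iSup_le fun d => iSup_le fun hn => iSup_le fun hs =>
      iSup_le fun hd => iSup_le fun h => Submodule.span_mono ?_
    rintro x ⟨p, q, rfl, h1, h2, h3⟩
    refine ⟨p, q, rfl, le_trans ?_ (h.trans h1)⟩
    gcongr
  · refine Submodule.span_le.2 ?_
    rintro x ⟨p, q, rfl, h⟩
    have : mon F γ p q ∈ spanV F γ ((p.length : ℝ) + q.length)
        ((γ.sd p.edges : ℝ) + γ.sd q.edges) |(p.length : ℝ) - q.length| :=
      Submodule.subset_span ⟨p, q, rfl, le_rfl, le_rfl, le_rfl⟩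
    refine Submodule.mem_iSup_of_mem _ (Submodule.mem_iSup_of_mem _ (Submodule.mem_iSup_of_mem _
      (Submodule.mem_iSup_of_mem (by positivity) (Submodule.mem_iSup_of_mem (by positivity)
      (Submodule.mem_iSup_of_mem (by positivity) (Submodule.mem_iSup_of_mem h this))))))

theorem nbhd_anti {k m : ℕ} (h : k ≤ m) : nbhd F γ m ≤ nbhd F γ k := by
  rw [nbhd_eq_span, nbhd_eq_span]
  refine Submodule.span_mono ?_
  rintro x ⟨p, q, rfl, hx⟩
  refine ⟨p, q, rfl, le_trans ?_ hx⟩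
  gcongr

/-- The estimate for a product of two elements `p q^*`. -/
theorem mon_mul_mem (k : ℕ) (p₁ q₁ p₂ q₂ : Γ.Path)
    (h : (k : ℝ) * ((γ.sd p₁.edges + γ.sd q₁.edges + |(p₁.length : ℝ) - q₁.length|) +
      (γ.sd p₂.edges + γ.sd q₂.edges + |(p₂.length : ℝ) - q₂.length|) + 1) ≤
        p₁.length + q₂.length) :
    mon F γ p₁ q₁ * mon F γ p₂ q₂ ∈ nbhd F γ k := by
  rcases mon_mul_mon (F := F) γ p₁ q₁ p₂ q₂ with h0 | ⟨p, q, h0, h1, h2, h3⟩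
  · rw [h0]; exact zero_mem _
  rw [h0, nbhd_eq_span]
  refine Submodule.subset_span ⟨p, q, rfl, ?_⟩
  have h1' : (p.length : ℝ) - q.length =
    (p₁.length - q₁.length) + (p₂.length - q₂.length) := by exact_mod_cast h1
  have h2' : (γ.sd p.edges : ℝ) + γ.sd q.edges ≤
    γ.sd p₁.edges + γ.sd q₁.edges + (γ.sd p₂.edges + γ.sd q₂.edges) := by exact_mod_cast h2
  have h3' : (p₁.length : ℝ) + q₂.length ≤ p.length + q.length := by exact_mod_cast h3
  have h4 := abs_add_le ((p₁.length : ℝ) - q₁.length) (p₂.length - q₂.length)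
  rw [h1']
  refine le_trans (mul_le_mul_of_nonneg_left ?_ (Nat.cast_nonneg k)) (h.trans h3')
  linarith

theorem nbhd_mul (k : ℕ) {x y : Leavitt F γ} (hx : x ∈ nbhd F γ (2 * k + 1))
    (hy : y ∈ nbhd F γ (2 * k + 1)) : x * y ∈ nbhd F γ k := by
  rw [nbhd_eq_span] at hx hy
  induction hx using Submodule.span_induction with
  | zero => simp
  | add a b _ _ ha hb => rw [add_mul]; exact add_mem ha hb
  | smul c a _ ha => rw [smul_mul_assoc]; exact Submodule.smul_mem _ _ ha
  | mem a ha =>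
    obtain ⟨p₁, q₁, rfl, h1⟩ := ha
    induction hy using Submodule.span_induction with
    | zero => simp
    | add a b _ _ ha hb => rw [mul_add]; exact add_mem ha hb
    | smul c a _ ha => rw [mul_smul_comm]; exact Submodule.smul_mem _ _ ha
    | mem b hb =>
      obtain ⟨p₂, q₂, rfl, h2⟩ := hb
      apply mon_mul_mem
      push_cast at h1 h2
      have e1 := neg_abs_le ((p₁.length : ℝ) - q₁.length)
      have e2 := le_abs_self ((p₂.length : ℝ) - q₂.length)
      have k0 : (0 : ℝ) ≤ k := Nat.cast_nonneg k
      have s1 : (0 : ℝ) ≤ γ.sd p₁.edges + γ.sd q₁.edges := by positivity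
      have s2 : (0 : ℝ) ≤ γ.sd p₂.edges + γ.sd q₂.edges := by positivity
      nlinarith

/-- Left multiplication by `x` is continuous at `0` for the filtration `V_k`. -/
theorem exists_left (x : Leavitt F γ) (k : ℕ) :
    ∃ m, ∀ y ∈ nbhd F γ m, x * y ∈ nbhd F γ k := by
  have hmon : ∀ (p q : Γ.Path) (k : ℕ), ∃ m, ∀ y ∈ nbhd F γ m, mon F γ p q * y ∈ nbhd F γ k := by
    intro p q k
    obtain ⟨c, hc⟩ := exists_nat_ge
      (γ.sd p.edges + γ.sd q.edges + |(p.length : ℝ) - q.length| + 1)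
    refine ⟨2 * (k * c) + 1, fun y hy => ?_⟩
    rw [nbhd_eq_span] at hy
    induction hy using Submodule.span_induction with
    | zero => simp
    | add a b _ _ ha hb => rw [mul_add]; exact add_mem ha hb
    | smul c a _ ha => rw [mul_smul_comm]; exact Submodule.smul_mem _ _ ha
    | mem b hb =>
      obtain ⟨p₂, q₂, rfl, h2⟩ := hb
      apply mon_mul_mem
      push_cast at h2
      have e2 := le_abs_self ((p₂.length : ℝ) - q₂.length)
      have k0 : (0 : ℝ) ≤ k := Nat.cast_nonneg k
      have p0 : (0 : ℝ) ≤ p.length := Nat.cast_nonneg _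
      have s1 : (0 : ℝ) ≤ γ.sd p.edges + γ.sd q.edges + |(p.length : ℝ) - q.length| := by
        positivity
      have s2 : (0 : ℝ) ≤ γ.sd p₂.edges + γ.sd q₂.edges := by positivity
      have s3 := abs_nonneg ((p₂.length : ℝ) - q₂.length)
      set A := (γ.sd p.edges : ℝ) + γ.sd q.edges + |(p.length : ℝ) - q.length|
      set B := (γ.sd p₂.edges : ℝ) + γ.sd q₂.edges + |(p₂.length : ℝ) - q₂.length| with hB
      have hB0 : 0 ≤ B := by positivity
      have key : A + B + 1 ≤ c * (B + 1) := by nlinarith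
      have := mul_le_mul_of_nonneg_left key k0
      nlinarith
  obtain ⟨a, rfl⟩ := RingQuot.mkAlgHom_surjective F (Rel F Γ) x
  change ∃ m, ∀ y ∈ nbhd F γ m, quot F γ a * y ∈ nbhd F γ k
  induction a using FreeAlgebra.induction generalizing k with
  | grade0 r =>
    refine ⟨k, fun y hy => ?_⟩
    rw [AlgHom.commutes, ← Algebra.smul_def]
    exact Submodule.smul_mem _ _ hy
  | grade1 g =>
    cases g with
    | vert v =>
      change ∃ m, ∀ y ∈ nbhd F γ m, vert F γ v * y ∈ nbhd F γ k
      rw [vert_eq_mon]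
      exact hmon _ _ _
    | edge e =>
      change ∃ m, ∀ y ∈ nbhd F γ m, edge F γ e * y ∈ nbhd F γ k
      rw [edge_eq_mon]
      exact hmon _ _ _
    | ghost e =>
      change ∃ m, ∀ y ∈ nbhd F γ m, ghost F γ e * y ∈ nbhd F γ k
      rw [ghost_eq_mon]
      exact hmon _ _ _
  | mul a b iha ihb =>
    obtain ⟨m, hm⟩ := iha k
    obtain ⟨m', hm'⟩ := ihb m
    refine ⟨m', fun y hy => ?_⟩
    rw [map_mul, mul_assoc]
    exact hm _ (hm' _ hy)
  | add a b iha ihb =>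
    obtain ⟨m, hm⟩ := iha k
    obtain ⟨m', hm'⟩ := ihb k
    refine ⟨max m m', fun y hy => ?_⟩
    rw [map_add, add_mul]
    exact add_mem (hm _ (nbhd_anti γ (le_max_left _ _) hy))
      (hm' _ (nbhd_anti γ (le_max_right _ _) hy))

/-- Right multiplication by `x` is continuous at `0` for the filtration `V_k`. -/
theorem exists_right (x : Leavitt F γ) (k : ℕ) :
    ∃ m, ∀ y ∈ nbhd F γ m, y * x ∈ nbhd F γ k := by
  have hmon : ∀ (p q : Γ.Path) (k : ℕ), ∃ m, ∀ y ∈ nbhd F γ m, y * mon F γ p q ∈ nbhd F γ k := by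
    intro p q k
    obtain ⟨c, hc⟩ := exists_nat_ge
      (γ.sd p.edges + γ.sd q.edges + |(p.length : ℝ) - q.length| + 1)
    refine ⟨2 * (k * c) + 1, fun y hy => ?_⟩
    rw [nbhd_eq_span] at hy
    induction hy using Submodule.span_induction with
    | zero => simp
    | add a b _ _ ha hb => rw [add_mul]; exact add_mem ha hb
    | smul c a _ ha => rw [smul_mul_assoc]; exact Submodule.smul_mem _ _ ha
    | mem b hb =>
      obtain ⟨p₂, q₂, rfl, h2⟩ := hb
      apply mon_mul_mem
      push_cast at h2
      have e2 := neg_abs_le ((p₂.length : ℝ) - q₂.length)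
      have k0 : (0 : ℝ) ≤ k := Nat.cast_nonneg k
      have p0 : (0 : ℝ) ≤ q.length := Nat.cast_nonneg _
      have s1 : (0 : ℝ) ≤ γ.sd p.edges + γ.sd q.edges + |(p.length : ℝ) - q.length| := by
        positivity
      have s2 : (0 : ℝ) ≤ γ.sd p₂.edges + γ.sd q₂.edges := by positivity
      have s3 := abs_nonneg ((p₂.length : ℝ) - q₂.length)
      set A := (γ.sd p.edges : ℝ) + γ.sd q.edges + |(p.length : ℝ) - q.length|
      set B := (γ.sd p₂.edges : ℝ) + γ.sd q₂.edges + |(p₂.length : ℝ) - q₂.length| with hB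
      have hB0 : 0 ≤ B := by positivity
      have key : B + A + 1 ≤ c * (B + 1) := by nlinarith
      have := mul_le_mul_of_nonneg_left key k0
      nlinarith
  obtain ⟨a, rfl⟩ := RingQuot.mkAlgHom_surjective F (Rel F Γ) x
  change ∃ m, ∀ y ∈ nbhd F γ m, y * quot F γ a ∈ nbhd F γ k
  induction a using FreeAlgebra.induction generalizing k with
  | grade0 r =>
    refine ⟨k, fun y hy => ?_⟩
    rw [AlgHom.commutes, ← Algebra.commutes, ← Algebra.smul_def]
    exact Submodule.smul_mem _ _ hy
  | grade1 g =>
    cases g with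
    | vert v =>
      change ∃ m, ∀ y ∈ nbhd F γ m, y * vert F γ v ∈ nbhd F γ k
      rw [vert_eq_mon]
      exact hmon _ _ _
    | edge e =>
      change ∃ m, ∀ y ∈ nbhd F γ m, y * edge F γ e ∈ nbhd F γ k
      rw [edge_eq_mon]
      exact hmon _ _ _
    | ghost e =>
      change ∃ m, ∀ y ∈ nbhd F γ m, y * ghost F γ e ∈ nbhd F γ k
      rw [ghost_eq_mon]
      exact hmon _ _ _
  | mul a b iha ihb =>
    obtain ⟨m, hm⟩ := ihb k
    obtain ⟨m', hm'⟩ := iha m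
    refine ⟨m', fun y hy => ?_⟩
    rw [map_mul, ← mul_assoc]
    exact hm _ (hm' _ hy)
  | add a b iha ihb =>
    obtain ⟨m, hm⟩ := iha k
    obtain ⟨m', hm'⟩ := ihb k
    refine ⟨max m m', fun y hy => ?_⟩
    rw [map_add, mul_add]
    exact add_mem (hm _ (nbhd_anti γ (le_max_left _ _) hy))
      (hm' _ (nbhd_anti γ (le_max_right _ _) hy))

theorem ringSubgroupsBasis :
    RingSubgroupsBasis fun k : ℕ => (nbhd F γ (k + 1)).toAddSubgroup where
  inter i j := ⟨max i j, le_inf (nbhd_anti γ (by omega)) (nbhd_anti γ (by omega))⟩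
  mul i := ⟨2 * (i + 1), by
    rintro _ ⟨x, hx, y, hy, rfl⟩
    exact nbhd_mul γ (i + 1) hx hy⟩
  leftMul x i := by
    obtain ⟨m, hm⟩ := exists_left γ x (i + 1)
    exact ⟨m, fun y hy => hm y (nbhd_anti γ (by omega) hy)⟩
  rightMul x i := by
    obtain ⟨m, hm⟩ := exists_right γ x (i + 1)
    exact ⟨m, fun y hy => hm y (nbhd_anti γ (by omega) hy)⟩

end topology

/-- The topology on `L(Γ)` in which the subspaces `V_k`, `k ≥ 1`, are a basis of neighbourhoods
of `0`. -/
instance (γ : Γ.Specialization) : TopologicalSpace (Leavitt F γ) :=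
  (ringSubgroupsBasis γ).topology

instance (γ : Γ.Specialization) : IsTopologicalRing (Leavitt F γ) :=
  (ringSubgroupsBasis γ).toRingFilterBasis.isTopologicalRing

instance (γ : Γ.Specialization) : UniformSpace (Leavitt F γ) :=
  IsTopologicalAddGroup.rightUniformSpace (Leavitt F γ)

instance (γ : Γ.Specialization) : IsUniformAddGroup (Leavitt F γ) :=
  isUniformAddGroup_of_addCommGroup

instance (γ : Γ.Specialization) : ContinuousConstSMul F (Leavitt F γ) where
  continuous_const_smul c := by
    simp only [Algebra.smul_def]
    exact continuous_const.mul continuous_id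

instance (γ : Γ.Specialization) : UniformContinuousConstSMul F (Leavitt F γ) :=
  uniformContinuousConstSMul_of_continuousConstSMul F _

theorem component_mul (γ : Γ.Specialization) (i j : ℤ) {x y : Leavitt F γ}
    (hx : x ∈ component F γ i) (hy : y ∈ component F γ j) : x * y ∈ component F γ (i + j) := by
  unfold component at hx hy
  induction hx using Submodule.span_induction with
  | zero => simp
  | add a b _ _ ha hb => rw [add_mul]; exact add_mem ha hb
  | smul c a _ ha => rw [smul_mul_assoc]; exact Submodule.smul_mem _ _ ha
  | mem a ha =>
    obtain ⟨p₁, q₁, rfl, rfl⟩ := ha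
    induction hy using Submodule.span_induction with
    | zero => simp
    | add a b _ _ ha hb => rw [mul_add]; exact add_mem ha hb
    | smul c a _ ha => rw [mul_smul_comm]; exact Submodule.smul_mem _ _ ha
    | mem b hb =>
      obtain ⟨p₂, q₂, rfl, rfl⟩ := hb
      rcases mon_mul_mon (F := F) γ p₁ q₁ p₂ q₂ with h0 | ⟨p, q, h0, h1, -, -⟩
      · rw [h0]; exact zero_mem _
      · rw [h0]; exact Submodule.subset_span ⟨p, q, rfl, h1⟩

theorem one_mem_component (γ : Γ.Specialization) : (1 : Leavitt F γ) ∈ component F γ 0 := by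
  rw [← sum_vert]
  refine Submodule.sum_mem _ fun v _ => ?_
  rw [vert_eq_mon]
  exact Submodule.subset_span ⟨_, _, rfl, by simp⟩

/-- The canonical map from `L(Γ)` to its completion. -/
def toCompletion (F : Type*) [Field F] {V E : Type*} [Fintype V] [Fintype E] {Γ : DirGraph V E}
    (γ : Γ.Specialization) : Leavitt F γ →ₐ[F] UniformSpace.Completion (Leavitt F γ) :=
  { UniformSpace.Completion.coeRingHom with commutes' := fun _ => rfl }

/-- The closure of the homogeneous component `L(Γ)_i` in the completion of the topological
algebra `L(Γ)`. -/
def closedComponent (F : Type*) [Field F] {V E : Type*} [Fintype V] [Fintype E] {Γ : DirGraph V E}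
    (γ : Γ.Specialization) (i : ℤ) : Submodule F (UniformSpace.Completion (Leavitt F γ)) :=
  ((component F γ i).map (toCompletion F γ).toLinearMap).topologicalClosure

theorem closedComponent_mul (γ : Γ.Specialization) (i j : ℤ)
    {x y : UniformSpace.Completion (Leavitt F γ)} (hx : x ∈ closedComponent F γ i)
    (hy : y ∈ closedComponent F γ j) : x * y ∈ closedComponent F γ (i + j) := by
  refine map_mem_closure₂ continuous_mul hx hy ?_
  rintro _ ⟨a, ha, rfl⟩ _ ⟨b, hb, rfl⟩
  exact ⟨a * b, component_mul γ i j ha hb, map_mul (toCompletion F γ) a b⟩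

theorem mem_closedComponent (γ : Γ.Specialization) (i : ℤ) {x : Leavitt F γ}
    (hx : x ∈ component F γ i) : toCompletion F γ x ∈ closedComponent F γ i :=
  Submodule.le_topologicalClosure _ ⟨x, hx, rfl⟩

end Leavitt

open Leavitt

/-- The graded completion of `L(Γ)`: the sum of the closures of the homogeneous components, a
subalgebra of the completion, with the subspace topology. -/
def GradedCompletion (F : Type*) [Field F] {V E : Type*} [Fintype V] [Fintype E]
    {Γ : DirGraph V E} (γ : Γ.Specialization) :
    Subalgebra F (UniformSpace.Completion (Leavitt F γ)) :=
  Submodule.toSubalgebra (⨆ i : ℤ, closedComponent F γ i)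
    (Submodule.mem_iSup_of_mem 0 (by
      simpa using mem_closedComponent γ 0 (one_mem_component γ)))
    (by
      intro x y hx hy
      induction hx using Submodule.iSup_induction' with
      | zero => simp
      | add a b _ _ ha hb => rw [add_mul]; exact add_mem ha hb
      | mem i a ha =>
        induction hy using Submodule.iSup_induction' with
        | zero => simp
        | add a b _ _ ha hb => rw [mul_add]; exact add_mem ha hb
        | mem j b hb =>
          exact Submodule.mem_iSup_of_mem (i + j) (closedComponent_mul γ i j ha hb))

namespace GradedCompletion

/-- The homogeneous component of degree `i` of the graded completion. -/
def component (F : Type*) [Field F] {V E : Type*} [Fintype V] [Fintype E] {Γ : DirGraph V E}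
    (γ : Γ.Specialization) (i : ℤ) : Submodule F (GradedCompletion F γ) :=
  (closedComponent F γ i).comap (GradedCompletion F γ).val.toLinearMap

/-- The element `p q^*` of `L(Γ)`, as an element of the graded completion. -/
def mon (F : Type*) [Field F] {V E : Type*} [Fintype V] [Fintype E] {Γ : DirGraph V E}
    (γ : Γ.Specialization) (p q : Γ.Path) : GradedCompletion F γ :=
  ⟨toCompletion F γ (Leavitt.mon F γ p q),
    Submodule.mem_iSup_of_mem ((p.length : ℤ) - q.length)
      (mem_closedComponent γ _ (Submodule.subset_span ⟨p, q, rfl, rfl⟩))⟩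

/-- The vertex `v` as an element of the graded completion. -/
def vert (F : Type*) [Field F] {V E : Type*} [Fintype V] [Fintype E] {Γ : DirGraph V E}
    (γ : Γ.Specialization) (v : V) : GradedCompletion F γ :=
  ⟨toCompletion F γ (Leavitt.vert F γ v),
    Submodule.mem_iSup_of_mem 0 (mem_closedComponent γ _ (by
      rw [vert_eq_mon]
      exact Submodule.subset_span ⟨_, _, rfl, by simp⟩))⟩

/-- The element `e_v`, the limit of `g_v(n) g_v(n)^*` as `n → ∞`. -/
def specialIdempotent (F : Type*) [Field F] {V E : Type*} [Fintype V] [Fintype E]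
    {Γ : DirGraph V E} (γ : Γ.Specialization) (v : V) : GradedCompletion F γ :=
  limUnder atTop fun n => mon F γ (γ.specialPath v n) (γ.specialPath v n)

/-- The closed (two-sided) ideal generated by a set. -/
def closedIdeal {F : Type*} [Field F] {V E : Type*} [Fintype V] [Fintype E] {Γ : DirGraph V E}
    {γ : Γ.Specialization} (S : Set (GradedCompletion F γ)) : Ideal (GradedCompletion F γ) :=
  sInf {I | I.IsTwoSided ∧ IsClosed (I : Set (GradedCompletion F γ)) ∧ S ⊆ I}

/-- A subspace is graded if it is spanned by its homogeneous elements. -/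
def IsGraded {F : Type*} [Field F] {V E : Type*} [Fintype V] [Fintype E] {Γ : DirGraph V E}
    {γ : Γ.Specialization} (K : Submodule F (GradedCompletion F γ)) : Prop :=
  K = ⨆ i : ℤ, K ⊓ component F γ i

/-- The closed ideal `J`, as a topological algebra, is graded simple: it is graded, its
multiplication is not zero, and `0` and `J` are the only closed graded ideals of the algebra `J`. -/
def IsTopGradedSimple {F : Type*} [Field F] {V E : Type*} [Fintype V] [Fintype E]
    {Γ : DirGraph V E} {γ : Γ.Specialization} (J : Ideal (GradedCompletion F γ)) : Prop :=
  IsGraded (J.restrictScalars F) ∧ (∃ x ∈ J, ∃ y ∈ J, x * y ≠ 0) ∧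
    ∀ K : Submodule F (GradedCompletion F γ), K ≤ J.restrictScalars F →
      IsClosed (K : Set (GradedCompletion F γ)) → IsGraded K →
      (∀ a ∈ J, ∀ x ∈ K, a * x ∈ K ∧ x * a ∈ K) → K = ⊥ ∨ K = J.restrictScalars F

/-- `J_c`, the closed ideal generated by the `e_v` with `v` in the connected component `c` of the
undirected graph of special edges. -/
def componentIdeal (F : Type*) [Field F] {V E : Type*} [Fintype V] [Fintype E] {Γ : DirGraph V E}
    (γ : Γ.Specialization) (c : γ.undirected.ConnectedComponent) :
    Ideal (GradedCompletion F γ) :=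
  closedIdeal (specialIdempotent F γ '' c.supp)

/-- `I(W)`, the closed ideal generated by the vertices in `W`. -/
def hereditaryIdeal (F : Type*) [Field F] {V E : Type*} [Fintype V] [Fintype E]
    {Γ : DirGraph V E} (γ : Γ.Specialization) (W : Set V) : Ideal (GradedCompletion F γ) :=
  closedIdeal (vert F γ '' W)

end GradedCompletion

end DirGraph

end

/-!
For a path `p` put `e_p = p e_{r(p)} p^*`, the projection to the boundary path that follows `p` and
then the special edges for ever. The idea is that the paths that are eventually special are the
indices of a system of matrix units. Everything rests on three facts about the idempotents `e_v`.

* They satisfy the recursion `e_{s(e)} = e e_{r(e)} e^*` for a special edge `e`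
  (`specialIdempotent_source`). So all `e_v` with `v` in one component of the graph of special edges
  generate the same ideal. The recursion also shows that `e_v p q^* e_w` vanishes unless `p` and `q`
  are special paths from `v` and `w`. Two consequences are that `e_v L̂ e_w = 0` if `v` and `w` are
  in different components, and that the elements `p q^*` of a given degree contribute at most a line
  to `e_v L̂ e_w`; the nonzero elements of this line are invertible up to the idempotents
  (`exists_mul_eq_specialIdempotent`).
* The line `F e_v` is discrete, in particular not zero, so the line above is closed and nothing is
  added by the completion. To see this one needs a linear functional on `L(Γ)` that vanishes on
  `V_1` and is `1` on all `g_v(n) g_v(n)^*`. It is a matrix coefficient of a representation of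
  `L(Γ)` on the functions on a set that is cut up by the edges as a set of boundary paths is
  (`Fan.rep`).
* The element `1` is the sum of the `e_p` over all paths `p` that have length `0` or end in an edge
  that is not special. Sorted by the component that contains `r(p)` this says `1 = ∑ ε_c` with `ε_c
  ∈ J_c` (`exists_sum_eq_one`). Instead of an infinite sum the proof uses the operator `T x = ∑ e x
  e^* + ∑ v x v` (`pushforward`), over the edges `e` and the sinks `v`. It fixes `1`, and `ε_c` is
  the limit of the `T^n x_c`, where `x_c` is the sum of the `e_v` with `v` in `c`. Both `T x_c -
  x_c` and `1 - ∑ x_c` lie in the closed span of elements `p q^*` with `l(p) = l(q)` and `sd(p) =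
  sd(q) = 0`; this is kept by `T`, which raises the lengths by one, so that its powers tend to `0`
  there.

Since `J_c L̂ J_d = 0` for `c ≠ d`, the element `ε_c` is the identity of `J_c`, and the direct
decomposition follows. A nonzero homogeneous `x` in an ideal of `J_c` satisfies `x = ε_c x ε_c`, so
some `e_v a x b e_w` with homogeneous `a` and `b` is not zero; by the first fact the ideal contains
`e_v` and hence is all of `J_c`, if it is closed. Finally a component that does not meet a
hereditary set `W` satisfies `J_c L̂ w = 0` for `w ∈ W`, so `I(W)` is the sum of the other `J_c`.
-/

noncomputable section

namespace DirGraph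

variable {F : Type*} [Field F] {V E : Type*}

/-! ### Paths and special edges -/

namespace Path

variable {Γ : DirGraph V E}

theorem ext_of_edges {p q : Γ.Path} (h₁ : p.src = q.src) (h₂ : p.edges = q.edges) : p = q := by
  cases p; cases q; simp_all

/-- The path `ep`, for an edge `e` that ends at the start of `p`. -/
def cons (e : E) (p : Γ.Path) (h : p.src = Γ.r e) : Γ.Path :=
  ⟨Γ.s e, e :: p.edges, rfl, h ▸ p.isPath⟩

end Path

namespace Specialization

variable {Γ : DirGraph V E} (γ : Γ.Specialization)

theorem isSpecial_edge (v : {v : V // Γ.NonSink v}) : γ.IsSpecial (γ.edge v) := ⟨v, rfl⟩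

theorem IsSpecial.eq_edge {γ : Γ.Specialization} {e : E} (h : γ.IsSpecial e)
    (v : {v : V // Γ.NonSink v}) (hv : Γ.s e = v) : e = γ.edge v := by
  obtain ⟨w, rfl⟩ := h
  rw [γ.s_edge] at hv
  rw [Subtype.ext hv]

theorem IsSpecial.eq_of_s_eq {γ : Γ.Specialization} {e f : E} (he : γ.IsSpecial e)
    (hf : γ.IsSpecial f) (h : Γ.s e = Γ.s f) : e = f :=
  (he.eq_edge ⟨Γ.s f, f, rfl⟩ h).trans (hf.eq_edge ⟨Γ.s f, f, rfl⟩ rfl).symm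

theorem sd_of_forall_isSpecial {l : List E} (h : ∀ e ∈ l, γ.IsSpecial e) : γ.sd l = l.length := by
  classical
  rw [sd, List.rtakeWhile_eq_self_iff.2]
  simpa using h

theorem sd_concat_of_not_isSpecial {e : E} (l : List E) (h : ¬ γ.IsSpecial e) :
    γ.sd (l ++ [e]) = 0 := by
  classical
  rw [sd, List.rtakeWhile_concat_neg]
  · rfl
  · simpa using h

/-- There is only one special path of given source and length. -/
theorem eq_of_forall_isSpecial {v : V} {l t : List E} (hl : Γ.IsPathFrom v l)
    (ht : Γ.IsPathFrom v t) (hl' : ∀ e ∈ l, γ.IsSpecial e) (ht' : ∀ e ∈ t, γ.IsSpecial e)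
    (h : l.length = t.length) : l = t := by
  induction l generalizing v t with
  | nil => exact (List.length_eq_zero_iff.1 h.symm).symm
  | cons e l ih =>
    cases t with
    | nil => simp at h
    | cons f t =>
      obtain ⟨rfl, hl⟩ := hl
      obtain ⟨hf, ht⟩ := ht
      obtain rfl : f = e := (ht' f (by simp)).eq_of_s_eq (hl' e (by simp)) hf
      rw [ih hl ht (fun e he => hl' e (by simp [he])) (fun e he => ht' e (by simp [he]))
        (by simpa using h)]

/-- The vertices of a special path lie in one connected component of the special edges. -/
theorem connectedComponentMk_endFrom {v : V} {l : List E} (hl : Γ.IsPathFrom v l)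
    (hl' : ∀ e ∈ l, γ.IsSpecial e) :
    γ.undirected.connectedComponentMk (Γ.endFrom v l) = γ.undirected.connectedComponentMk v := by
  induction l generalizing v with
  | nil => rfl
  | cons e l ih =>
    obtain ⟨rfl, hl⟩ := hl
    refine (ih hl fun e he => hl' e (by simp [he])).trans ?_
    by_cases h : Γ.r e = Γ.s e
    · rw [h]
    · refine SimpleGraph.ConnectedComponent.sound (SimpleGraph.Adj.reachable ?_)
      exact (SimpleGraph.fromRel_adj _ _ _).2 ⟨h, Or.inr ⟨e, hl' e (by simp), rfl, rfl⟩⟩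

end Specialization

/-! ### A representation of the Leavitt path algebra -/

/-- Injections `ℕ → ℕ`, one for each edge, such that for every vertex `v` which is not a sink `ℕ` is
the disjoint union of the images of the injections of the edges starting at `v`; special edges
fix `0`. -/
structure Fan {Γ : DirGraph V E} (γ : Γ.Specialization) where
  /-- the injection of an edge -/
  inj : E → ℕ → ℕ
  inj_eq : ∀ {e e' m m'}, Γ.s e = Γ.s e' → inj e m = inj e' m' → e = e' ∧ m = m'
  exists_eq : ∀ e n, ∃ e' m, Γ.s e' = Γ.s e ∧ inj e' m = n
  special : ∀ e, γ.IsSpecial e → inj e 0 = 0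

namespace Fan

theorem nonempty [Fintype E] {Γ : DirGraph V E} (γ : Γ.Specialization) : Nonempty (Fan γ) := by
  have key : ∀ v : {v : V // Γ.NonSink v}, ∃ Φ : {e // Γ.s e = v} × ℕ ≃ ℕ,
      Φ (⟨γ.edge v, γ.s_edge v⟩, 0) = 0 := by
    intro v
    have : Nonempty {e // Γ.s e = v} := ⟨⟨γ.edge v, γ.s_edge v⟩⟩
    obtain ⟨Φ⟩ := nonempty_equiv_of_countable (α := {e // Γ.s e = v} × ℕ) (β := ℕ)
    exact ⟨Φ.trans (Equiv.swap (Φ (⟨γ.edge v, γ.s_edge v⟩, 0)) 0), by simp⟩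
  choose Φ hΦ using key
  have hcast : ∀ (v w : {v : V // Γ.NonSink v}) (h : v = w) (e : E) (he : Γ.s e = v) (m : ℕ),
      Φ v (⟨e, he⟩, m) = Φ w (⟨e, h ▸ he⟩, m) := by
    rintro v _ rfl e he m; rfl
  refine ⟨⟨fun e m => Φ ⟨Γ.s e, e, rfl⟩ (⟨e, rfl⟩, m), ?_, ?_, ?_⟩⟩
  · intro e e' m m' hs h
    rw [hcast _ ⟨Γ.s e', e', rfl⟩ (Subtype.ext hs)] at h
    simpa using (Φ _).injective h
  · intro e n
    obtain ⟨⟨⟨e', he'⟩, m⟩, h⟩ := (Φ ⟨Γ.s e, e, rfl⟩).surjective n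
    refine ⟨e', m, he', ?_⟩
    rw [← h]
    exact hcast _ _ (Subtype.ext he') _ _ _
  · intro e he
    have h := hΦ ⟨Γ.s e, e, rfl⟩
    have he' := he.eq_edge ⟨Γ.s e, e, rfl⟩ rfl
    rw [← h]
    congr 3

variable {Γ : DirGraph V E} {γ : Γ.Specialization} (Φ : Fan γ)

theorem injective (e : E) : Function.Injective (Φ.inj e) := fun _ _ h => (Φ.inj_eq rfl h).2

theorem inj_eq_zero {e : E} {m : ℕ} : Φ.inj e m = 0 ↔ γ.IsSpecial e ∧ m = 0 := by
  constructor
  · intro h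
    have hs := Φ.special _ (γ.isSpecial_edge ⟨Γ.s e, e, rfl⟩)
    obtain ⟨h1, h2⟩ := Φ.inj_eq (γ.s_edge ⟨Γ.s e, e, rfl⟩).symm (h.trans hs.symm)
    exact ⟨h1 ▸ γ.isSpecial_edge _, h2⟩
  · rintro ⟨h, rfl⟩
    exact Φ.special e h

open Classical in
/-- The operators on functions `V × ℕ → F` by which the generators of `L(Γ)` act. The points
`(v, n)` play the part of boundary paths starting at `v`, with `(v, 0)` the special one; the
injection of an edge `e` stands for prefixing `e`. -/
def genAct (F : Type*) [Field F] : Gen V E → Module.End F (V × ℕ → F)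
  | .vert v =>
    { toFun := fun f x => if x.1 = v then f x else 0
      map_add' := fun f g => by ext x; by_cases h : x.1 = v <;> simp [h]
      map_smul' := fun c f => by ext x; by_cases h : x.1 = v <;> simp [h] }
  | .edge e =>
    { toFun := fun f x => if x.1 = Γ.s e then
        ((Function.partialInv (Φ.inj e)) x.2).elim 0 fun m => f (Γ.r e, m) else 0
      map_add' := fun f g => by
        ext x
        by_cases h : x.1 = Γ.s e <;> cases h' : Function.partialInv (Φ.inj e) x.2 <;> simp [h, h']
      map_smul' := fun c f => by
        ext x
        by_cases h : x.1 = Γ.s e <;> cases h' : Function.partialInv (Φ.inj e) x.2 <;>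
          simp [h, h'] }
  | .ghost e =>
    { toFun := fun f x => if x.1 = Γ.r e then f (Γ.s e, Φ.inj e x.2) else 0
      map_add' := fun f g => by ext x; by_cases h : x.1 = Γ.r e <;> simp [h]
      map_smul' := fun c f => by ext x; by_cases h : x.1 = Γ.r e <;> simp [h] }

open Classical in
theorem genAct_vert (v : V) (f : V × ℕ → F) (x : V × ℕ) :
    Φ.genAct F (.vert v) f x = if x.1 = v then f x else 0 := rfl

open Classical in
theorem genAct_ghost (e : E) (f : V × ℕ → F) (x : V × ℕ) :
    Φ.genAct F (.ghost e) f x = if x.1 = Γ.r e then f (Γ.s e, Φ.inj e x.2) else 0 := rfl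

theorem genAct_edge_inj (e : E) (f : V × ℕ → F) (m : ℕ) :
    Φ.genAct F (.edge e) f (Γ.s e, Φ.inj e m) = f (Γ.r e, m) := by
  have : Function.partialInv (Φ.inj e) (Φ.inj e m) = some m :=
    Function.partialInv_left (Φ.injective e) m
  simp [genAct, this]

theorem genAct_edge_of_ne (e : E) (f : V × ℕ → F) (x : V × ℕ)
    (h : ∀ m, (Γ.s e, Φ.inj e m) ≠ x) : Φ.genAct F (.edge e) f x = 0 := by
  obtain ⟨w, n⟩ := x
  by_cases hw : w = Γ.s e
  · subst hw
    have : Function.partialInv (Φ.inj e) n = none := by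
      rw [Option.eq_none_iff_forall_not_mem]
      intro m hm
      exact h m (by rw [((Φ.injective e).isPartialInv m n).1 hm])
    simp [genAct, this]
  · simp [genAct, hw]

theorem genAct_rel [Fintype V] [Fintype E] {a b : FreeAlgebra F (Gen V E)} (h : Rel F Γ a b) :
    FreeAlgebra.lift F (Φ.genAct F) a = FreeAlgebra.lift F (Φ.genAct F) b := by
  classical
  have edge_cases : ∀ (e : E) (x : V × ℕ),
      (∃ m, x = (Γ.s e, Φ.inj e m)) ∨ ∀ m, (Γ.s e, Φ.inj e m) ≠ x := by
    intro e x
    by_cases hx : ∃ m, x = (Γ.s e, Φ.inj e m)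
    · exact Or.inl hx
    · exact Or.inr fun m hm => hx ⟨m, hm.symm⟩
  induction h with
  | vert_vert v =>
    ext1 f; ext1 x
    by_cases hx : x.1 = v <;> simp [genAct_vert, hx]
  | vert_vert_ne v w h =>
    ext1 f; ext1 x
    by_cases hx : x.1 = v <;> simp [genAct_vert, hx, h]
  | source_edge e =>
    ext1 f; ext1 x
    rcases edge_cases e x with ⟨m, rfl⟩ | hx
    · simp [genAct_vert]
    · simp [genAct_vert, genAct_edge_of_ne Φ e _ _ hx]
  | edge_range e =>
    ext1 f; ext1 x
    rcases edge_cases e x with ⟨m, rfl⟩ | hx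
    · simp [genAct_vert, genAct_edge_inj]
    · simp [genAct_edge_of_ne Φ e _ _ hx]
  | range_ghost e =>
    ext1 f; ext1 x
    by_cases hx : x.1 = Γ.r e <;> simp [genAct_vert, genAct_ghost, hx]
  | ghost_source e =>
    ext1 f; ext1 x
    by_cases hx : x.1 = Γ.r e <;> simp [genAct_vert, genAct_ghost, hx]
  | ghost_edge e =>
    ext1 f; ext1 x
    obtain ⟨w, n⟩ := x
    by_cases hx : w = Γ.r e
    · subst hx; simp [genAct_vert, genAct_ghost, genAct_edge_inj]
    · simp [genAct_vert, genAct_ghost, hx]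
  | ghost_edge_ne e e' h =>
    ext1 f; ext1 x
    by_cases hx : x.1 = Γ.r e
    · have : ∀ m, (Γ.s e', Φ.inj e' m) ≠ (Γ.s e, Φ.inj e x.2) := by
        intro m hm
        rw [Prod.mk.injEq] at hm
        exact h (Φ.inj_eq hm.1 hm.2).1.symm
      simp [genAct_ghost, hx, genAct_edge_of_ne Φ e' _ _ this]
    · simp [genAct_ghost, hx]
  | sum_edge_ghost v h =>
    ext1 f; ext1 x
    obtain ⟨w, n⟩ := x
    simp only [FreeAlgebra.lift_ι_apply, map_sum, map_mul, LinearMap.sum_apply, Finset.sum_apply,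
      Module.End.mul_apply]
    by_cases hw : w = v
    · subst hw
      obtain ⟨e₀, rfl⟩ := h
      obtain ⟨e, m, he, rfl⟩ := Φ.exists_eq e₀ n
      rw [Finset.sum_eq_single e]
      · rw [← he, genAct_edge_inj]
        simp [genAct_ghost, genAct_vert]
      · intro e' _ hne
        refine genAct_edge_of_ne Φ _ _ _ fun m' hm => hne ?_
        rw [Prod.mk.injEq] at hm
        exact (Φ.inj_eq (hm.1.trans he.symm) hm.2).1
      · intro h
        simp [he] at h
    · rw [Finset.sum_eq_zero]
      · simp [genAct_vert, hw]
      · intro e he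
        refine genAct_edge_of_ne Φ _ _ _ fun m' hm => hw ?_
        rw [Prod.mk.injEq] at hm
        simpa [hm.1] using he
  | one =>
    ext1 f; ext1 x
    simp [genAct_vert]

/-- The representation of `L(Γ)` on functions `V × ℕ → F` given by a fan. -/
def rep [Fintype V] [Fintype E] (F : Type*) [Field F] :
    Leavitt F γ →ₐ[F] Module.End F (V × ℕ → F) :=
  RingQuot.liftAlgHom F ⟨FreeAlgebra.lift F (Φ.genAct F), fun _ _ h => Φ.genAct_rel h⟩

variable [Fintype V] [Fintype E]

theorem rep_quot (a : FreeAlgebra F (Gen V E)) :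
    Φ.rep F (Leavitt.quot F γ a) = FreeAlgebra.lift F (Φ.genAct F) a :=
  RingQuot.liftAlgHom_mkAlgHom_apply ..

theorem rep_vert (v : V) : Φ.rep F (Leavitt.vert F γ v) = Φ.genAct F (.vert v) := by
  simp [Leavitt.vert, rep_quot]

theorem rep_edge (e : E) : Φ.rep F (Leavitt.edge F γ e) = Φ.genAct F (.edge e) := by
  simp [Leavitt.edge, rep_quot]

theorem rep_ghost (e : E) : Φ.rep F (Leavitt.ghost F γ e) = Φ.genAct F (.ghost e) := by
  simp [Leavitt.ghost, rep_quot]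

open Classical in
theorem rep_listElt_apply_zero (v : V) (l : List E) (hl : Γ.IsPathFrom v l) (f : V × ℕ → F) :
    Φ.rep F (Leavitt.listElt F γ v l) f (v, 0) =
      if ∀ e ∈ l, γ.IsSpecial e then f (Γ.endFrom v l, 0) else 0 := by
  induction l generalizing v with
  | nil => simp [Leavitt.listElt, rep_vert, genAct_vert, endFrom]
  | cons e l ih =>
    obtain ⟨rfl, hl⟩ := hl
    rw [Leavitt.listElt_cons, map_mul, Module.End.mul_apply, rep_edge]
    by_cases he : γ.IsSpecial e
    · have := Φ.genAct_edge_inj e (Φ.rep F (Leavitt.listElt F γ (Γ.r e) l) f) 0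
      rw [Φ.special e he] at this
      rw [this, ih _ hl]
      simp [he, endFrom]
    · rw [genAct_edge_of_ne]
      · simp [he]
      · intro m hm
        rw [Prod.mk.injEq, Φ.inj_eq_zero] at hm
        exact he hm.2.1

open Classical in
theorem rep_listStar_apply (v : V) (l : List E) (hl : Γ.IsPathFrom v l) (x : V × ℕ) :
    Φ.rep F (Leavitt.listStar F γ v l) (fun x => if x.2 = 0 then 1 else 0) x =
      if (∀ e ∈ l, γ.IsSpecial e) ∧ x.1 = Γ.endFrom v l ∧ x.2 = 0 then 1 else 0 := by
  induction l using List.reverseRecOn generalizing x with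
  | nil => simp [Leavitt.listStar, rep_vert, genAct_vert, endFrom, ite_and]
  | append_singleton l e ih =>
    obtain ⟨hl, he, -⟩ := (Γ.isPathFrom_append _ _ _).1 hl
    have hstar : Leavitt.listStar F γ v (l ++ [e]) =
        Leavitt.ghost F γ e * Leavitt.listStar F γ v l := by
      simp [Leavitt.listStar, mul_assoc]
    rw [hstar, map_mul, Module.End.mul_apply, rep_ghost, genAct_ghost, ih hl]
    by_cases hx : x.1 = Γ.r e <;> by_cases hs : γ.IsSpecial e <;>
      simp [hx, hs, he, endFrom_append, endFrom, Φ.inj_eq_zero, or_imp, forall_and]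

/-- The coefficient of `L(Γ)` at the special boundary path from `v`: a linear functional that
detects the products `p q^*` with `p` and `q` special. -/
def coeff (F : Type*) [Field F] (v : V) : Leavitt F γ →ₗ[F] F :=
  (LinearMap.proj (v, 0)).comp
    ((LinearMap.applyₗ (fun x : V × ℕ => open Classical in if x.2 = 0 then (1 : F) else 0)).comp
      (Φ.rep F).toLinearMap)

theorem coeff_apply (v : V) (x : Leavitt F γ) : Φ.coeff F v x =
    Φ.rep F x (fun x : V × ℕ => open Classical in if x.2 = 0 then (1 : F) else 0) (v, 0) := rfl

theorem coeff_mon_self (p : Γ.Path) (hp : ∀ e ∈ p.edges, γ.IsSpecial e) :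
    Φ.coeff F p.src (Leavitt.mon F γ p p) = 1 := by
  classical
  rw [coeff_apply, Leavitt.mon, map_mul, Module.End.mul_apply,
    rep_listElt_apply_zero _ _ _ p.isPath, if_pos hp]
  refine (Φ.rep_listStar_apply _ _ p.isPath _).trans ?_
  rw [if_pos ⟨hp, rfl, rfl⟩]

/-- If `p q^*` has a nonzero coefficient, then `p` and `q` are special, and `p q^*` is far from
being one of the spanning elements of `V_1`. -/
theorem coeff_eq_zero_of_mem_nbhd (v : V) {x : Leavitt F γ} (hx : x ∈ Leavitt.nbhd F γ 1) :
    Φ.coeff F v x = 0 := by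
  classical
  rw [Leavitt.nbhd_eq_span] at hx
  refine (Submodule.span_le (p := LinearMap.ker (Φ.coeff F v))).2 ?_ hx
  rintro _ ⟨p, q, rfl, h⟩
  change Φ.coeff F v (Leavitt.mon F γ p q) = 0
  by_contra hne
  rw [coeff_apply, Leavitt.mon, map_mul, Module.End.mul_apply] at hne
  have hq : ∀ e ∈ q.edges, γ.IsSpecial e := by
    by_contra hq
    have : Φ.rep F (Leavitt.listStar F γ q.src q.edges)
        (fun x => if x.2 = 0 then 1 else 0) = 0 := by
      ext x
      rw [Φ.rep_listStar_apply _ _ q.isPath, if_neg fun h => hq h.1]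
      rfl
    apply hne
    rw [this, map_zero]
    rfl
  have hp : ∀ e ∈ p.edges, γ.IsSpecial e := by
    by_contra hp
    apply hne
    by_cases hv : v = p.src
    · rw [hv, rep_listElt_apply_zero _ _ _ p.isPath, if_neg hp]
    · rw [Leavitt.listElt, map_mul, Module.End.mul_apply, rep_vert, genAct_vert, if_neg hv]
  rw [γ.sd_of_forall_isSpecial hp, γ.sd_of_forall_isSpecial hq] at h
  have := abs_nonneg ((p.length : ℝ) - q.length)
  simp only [Path.length] at h this
  push_cast at h
  linarith

end Fan

/-! ### Products in the Leavitt path algebra -/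

namespace Leavitt

variable [Fintype V] [Fintype E] {Γ : DirGraph V E} (γ : Γ.Specialization)

theorem mon_eq_zero {p q : Γ.Path} (h : p.range ≠ q.range) : mon F γ p q = 0 := by
  rw [mon, ← listElt_mul_end γ _ _ p.isPath, ← end_mul_listStar γ _ _ q.isPath, mul_assoc,
    ← mul_assoc (vert F γ _), vert_vert_ne γ (show Γ.endFrom _ _ ≠ Γ.endFrom _ _ from h)]
  simp

theorem vert_mul_mon_of_ne {p q : Γ.Path} {v : V} (h : v ≠ p.src) :
    vert F γ v * mon F γ p q = 0 := by
  simp [mon, listElt, ← mul_assoc, vert_vert_ne γ h]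

theorem mon_mul_vert_of_ne {p q : Γ.Path} {v : V} (h : q.src ≠ v) :
    mon F γ p q * vert F γ v = 0 := by
  simp [mon, listStar, mul_assoc, vert_vert_ne γ h]

theorem vert_mul_mon (p q : Γ.Path) : vert F γ p.src * mon F γ p q = mon F γ p q := by
  simp [mon, listElt, ← mul_assoc, vert_vert]

theorem mon_mul_vert (p q : Γ.Path) : mon F γ p q * vert F γ q.src = mon F γ p q := by
  simp [mon, listStar, mul_assoc, vert_vert]

theorem edge_mul_vert_of_ne {e : E} {v : V} (h : Γ.r e ≠ v) : edge F γ e * vert F γ v = 0 := by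
  rw [← edge_range, mul_assoc, vert_vert_ne γ h, mul_zero]

open Classical in
theorem sum_edge_ghost (v : V) (h : Γ.NonSink v) :
    vert F γ v = ∑ e with Γ.s e = v, edge F γ e * ghost F γ e := by
  simpa [vert, ghost, edge] using quot_rel (F := F) γ (Rel.sum_edge_ghost v h)

theorem edge_mul_mon_mul_ghost (e : E) (p q : Γ.Path) (hp : p.src = Γ.r e) (hq : q.src = Γ.r e) :
    edge F γ e * mon F γ p q * ghost F γ e = mon F γ (p.cons e hp) (q.cons e hq) := by
  simp only [mon, Path.cons]
  rw [listElt_cons, listStar_cons, hp, hq]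
  simp only [mul_assoc]

theorem span_mon (F : Type*) [Field F] :
    Submodule.span F {x | ∃ p q : Γ.Path, x = mon F γ p q} = ⊤ := by
  rw [eq_top_iff]
  rintro x -
  obtain ⟨a, rfl⟩ := RingQuot.mkAlgHom_surjective F (Rel F Γ) x
  change quot F γ a ∈ _
  have hmon : ∀ p q : Γ.Path,
    mon F γ p q ∈ Submodule.span F {x | ∃ p q : Γ.Path, x = mon F γ p q} :=
    fun p q => Submodule.subset_span ⟨p, q, rfl⟩
  induction a using FreeAlgebra.induction with
  | grade0 r =>
    rw [AlgHom.commutes, Algebra.algebraMap_eq_smul_one, ← sum_vert]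
    refine Submodule.smul_mem _ _ (Submodule.sum_mem _ fun v _ => ?_)
    rw [vert_eq_mon]
    exact hmon _ _
  | grade1 g =>
    cases g with
    | vert v =>
      change vert F γ v ∈ _
      rw [vert_eq_mon]
      exact hmon _ _
    | edge e =>
      change edge F γ e ∈ _
      rw [edge_eq_mon]
      exact hmon _ _
    | ghost e =>
      change ghost F γ e ∈ _
      rw [ghost_eq_mon]
      exact hmon _ _
  | mul a b iha ihb =>
    rw [map_mul]
    have := Submodule.mul_mem_mul iha ihb
    rw [Submodule.span_mul_span] at this
    refine Submodule.span_le.2 ?_ this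
    rintro _ ⟨_, ⟨p₁, q₁, rfl⟩, _, ⟨p₂, q₂, rfl⟩, rfl⟩
    rcases mon_mul_mon (F := F) γ p₁ q₁ p₂ q₂ with h | ⟨p, q, h, -⟩
    · simp [h]
    · simp only [h]
      exact hmon _ _
  | add a b iha ihb => rw [map_add]; exact add_mem iha ihb

end Leavitt

end DirGraph

end

noncomputable section

namespace DirGraph

open Leavitt

variable {F : Type*} [Field F] {V E : Type*} {Γ : DirGraph V E} (γ : Γ.Specialization)

namespace Path

theorem range_cons (e : E) (p : Γ.Path) (h : p.src = Γ.r e) : (p.cons e h).range = p.range := by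
  simp [range, Path.cons, endFrom, h]

/-- Paths of positive length whose last edge is not special; these are the paths of positive length
with `sd(p) = 0`. -/
def EndsNonspecial (γ : Γ.Specialization) (p : Γ.Path) : Prop :=
  ∃ l e, p.edges = l ++ [e] ∧ ¬ γ.IsSpecial e

theorem EndsNonspecial.sd_eq {γ : Γ.Specialization} {p : Γ.Path} (h : p.EndsNonspecial γ) :
    γ.sd p.edges = 0 := by
  obtain ⟨l, e, h, he⟩ := h
  rw [h, γ.sd_concat_of_not_isSpecial l he]

end Path

/-! ### The topology of the graded completion -/

namespace GradedCompletion

variable [Fintype V] [Fintype E]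

theorem toCompletion_mem (x : Leavitt F γ) : toCompletion F γ x ∈ GradedCompletion F γ := by
  have hx : x ∈ Submodule.span F {x | ∃ p q : Γ.Path, x = Leavitt.mon F γ p q} := by
    rw [span_mon]; trivial
  induction hx using Submodule.span_induction with
  | zero => rw [map_zero]; exact zero_mem _
  | add a b _ _ ha hb => rw [map_add]; exact add_mem ha hb
  | smul c a _ ha => rw [map_smul]; exact Subalgebra.smul_mem _ ha c
  | mem a ha =>
    obtain ⟨p, q, rfl⟩ := ha
    exact (mon F γ p q).2

/-- The canonical map from `L(Γ)` to its graded completion. -/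
def of : Leavitt F γ →ₐ[F] GradedCompletion F γ :=
  (toCompletion F γ).codRestrict _ (toCompletion_mem γ)

theorem of_mon (p q : Γ.Path) : of γ (Leavitt.mon F γ p q) = mon F γ p q := rfl

theorem of_vert (v : V) : of γ (Leavitt.vert F γ v) = vert F γ v := rfl

instance : IsTopologicalRing (GradedCompletion F γ) where
  continuous_neg := (continuous_subtype_val.neg).subtype_mk _

instance : ContinuousConstSMul F (GradedCompletion F γ) where
  continuous_const_smul c := (continuous_subtype_val.const_smul c).subtype_mk _

theorem isInducing_of : IsInducing (of (F := F) γ) :=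
  (IsInducing.of_comp_iff IsInducing.subtypeVal).1 UniformSpace.Completion.isDenseInducing_coe.1

/-- The homogeneous components of the graded completion are the closures of those of `L(Γ)`. -/
theorem component_eq_closure (i : ℤ) : (component F γ i : Set (GradedCompletion F γ)) =
    closure (of γ '' Leavitt.component F γ i) := by
  rw [IsInducing.subtypeVal.closure_eq_preimage_closure_image, ← Set.image_comp]
  rfl

theorem component_mul {i j : ℤ} {x y : GradedCompletion F γ} (hx : x ∈ component F γ i)
    (hy : y ∈ component F γ j) : x * y ∈ component F γ (i + j) :=
  closedComponent_mul γ i j hx hy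

theorem of_mem_component {i : ℤ} {x : Leavitt F γ} (hx : x ∈ Leavitt.component F γ i) :
    of γ x ∈ component F γ i :=
  mem_closedComponent γ i hx

theorem iSup_component : ⨆ i, component F γ i = ⊤ := by
  have hinj : Function.Injective (GradedCompletion F γ).val.toLinearMap := Subtype.val_injective
  rw [eq_top_iff]
  rintro ⟨x, hx⟩ -
  have hx' : x ∈ ⨆ i : ℤ, closedComponent F γ i := hx
  have : ∀ i, closedComponent F γ i =
      (component F γ i).map (GradedCompletion F γ).val.toLinearMap := by
    intro i
    rw [component, Submodule.map_comap_eq, inf_eq_right.2]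
    intro y hy
    exact ⟨⟨y, Submodule.mem_iSup_of_mem i hy⟩, rfl⟩
  simp_rw [this, ← Submodule.map_iSup] at hx'
  obtain ⟨y, hy, rfl⟩ := hx'
  exact hy

/-- Density: to place `a x b`, for `x` homogeneous of degree `i`, in a closed subspace, it is enough
to treat the elements `x = p q^*` of degree `i`. -/
theorem mul_mul_mem_of_mem_component {a b : GradedCompletion F γ}
    {T : Submodule F (GradedCompletion F γ)} (hT : IsClosed (T : Set (GradedCompletion F γ)))
    {i : ℤ} (h : ∀ p q : Γ.Path, (p.length : ℤ) - q.length = i → a * mon F γ p q * b ∈ T)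
    {x : GradedCompletion F γ} (hx : x ∈ component F γ i) : a * x * b ∈ T := by
  have hc : Continuous fun x : GradedCompletion F γ => a * x * b :=
    (continuous_const.mul continuous_id).mul continuous_const
  have hx' : x ∈ closure (of γ '' Leavitt.component F γ i) := by
    rw [← component_eq_closure]; exact hx
  have hle : Leavitt.component F γ i ≤
      T.comap ((LinearMap.mulLeftRight F (a, b)).comp (of γ).toLinearMap) := by
    refine Submodule.span_le.2 ?_
    rintro _ ⟨p, q, rfl, hi⟩
    exact h p q hi
  refine closure_minimal ?_ (hT.preimage hc) hx'
  rintro _ ⟨y, hy, rfl⟩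
  exact hle hy

theorem mul_mul_mem {a b : GradedCompletion F γ}
    {T : Submodule F (GradedCompletion F γ)} (hT : IsClosed (T : Set (GradedCompletion F γ)))
    (h : ∀ p q : Γ.Path, a * mon F γ p q * b ∈ T) (x : GradedCompletion F γ) : a * x * b ∈ T := by
  have hx : x ∈ ⨆ i, component F γ i := by rw [iSup_component]; trivial
  induction hx using Submodule.iSup_induction' with
  | zero => simp
  | add c d _ _ hc hd => rw [mul_add, add_mul]; exact add_mem hc hd
  | mem i c hc => exact mul_mul_mem_of_mem_component γ hT (fun p q _ => h p q) hc

theorem isDenseInducing_of : IsDenseInducing (of (F := F) γ) := by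
  refine ⟨isInducing_of γ, fun x => ?_⟩
  have := mul_mul_mem γ (a := 1) (b := 1)
    (T := (LinearMap.range (of (F := F) γ).toLinearMap).topologicalClosure) isClosed_closure
    (fun p q => Submodule.le_topologicalClosure _ ⟨Leavitt.mon F γ p q, by simp [of_mon]⟩) x
  simp only [one_mul, mul_one] at this
  exact this

theorem hasBasis_nhds_zero : (𝓝 (0 : GradedCompletion F γ)).HasBasis (fun _ => True)
    fun k : ℕ => closure (of γ '' nbhd F γ (k + 1)) := by
  have := (ringSubgroupsBasis (F := F) γ).hasBasis_nhds_zero.hasBasis_of_isDenseInducing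
    (isDenseInducing_of γ)
  rwa [map_zero] at this

/-- The closed span of the products `p q^*` of paths of equal length greater than `m` which end
in edges that are not special. -/
def tail (F : Type*) [Field F] (m : ℕ) : Submodule F (GradedCompletion F γ) :=
  (Submodule.span F {x | ∃ p q : Γ.Path, x = mon F γ p q ∧ p.EndsNonspecial γ ∧
    q.EndsNonspecial γ ∧ p.length = q.length ∧ m < p.length}).topologicalClosure

variable {γ}

theorem mon_mem_tail {m : ℕ} {p q : Γ.Path} (hp : p.EndsNonspecial γ) (hq : q.EndsNonspecial γ)
    (h : p.length = q.length) (hm : m < p.length) : mon F γ p q ∈ tail γ F m :=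
  Submodule.le_topologicalClosure _ (Submodule.subset_span ⟨p, q, rfl, hp, hq, h, hm⟩)

theorem isClosed_tail (m : ℕ) : IsClosed (tail γ F m : Set (GradedCompletion F γ)) :=
  isClosed_closure

theorem tail_anti {m n : ℕ} (h : m ≤ n) : tail γ F n ≤ tail γ F m := by
  refine Submodule.topologicalClosure_mono (Submodule.span_mono ?_)
  rintro _ ⟨p, q, rfl, hp, hq, hl, hn⟩
  exact ⟨p, q, rfl, hp, hq, hl, by omega⟩

theorem tail_subset (k : ℕ) :
    (tail γ F k : Set (GradedCompletion F γ)) ⊆ closure (of γ '' nbhd F γ (k + 1)) := by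
  refine closure_mono ?_
  change ((Submodule.span F _ : Submodule F (GradedCompletion F γ)) : Set _) ⊆
    ((nbhd F γ (k + 1)).map (of γ).toLinearMap : Set (GradedCompletion F γ))
  refine SetLike.coe_subset_coe.2 (Submodule.span_le.2 ?_)
  rintro _ ⟨p, q, rfl, hp, hq, hl, hk⟩
  refine ⟨Leavitt.mon F γ p q, ?_, rfl⟩
  rw [nbhd_eq_span]
  refine Submodule.subset_span ⟨p, q, rfl, ?_⟩
  have : ((k + 1 : ℕ) : ℝ) ≤ p.length := by exact_mod_cast hk
  rw [hp.sd_eq, hq.sd_eq, ← hl]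
  push_cast at this ⊢
  simp only [sub_self, abs_zero]
  linarith

theorem tendsto_zero_of_mem_tail {z : ℕ → GradedCompletion F γ} (hz : ∀ n, z n ∈ tail γ F n) :
    Tendsto z atTop (𝓝 0) := by
  refine (hasBasis_nhds_zero γ).tendsto_right_iff.2 fun k _ => ?_
  filter_upwards [eventually_ge_atTop k] with n hn
  exact tail_subset k (tail_anti hn (hz n))

instance : NonarchimedeanRing (Leavitt F γ) := (ringSubgroupsBasis γ).nonarchimedean

/-- The component of degree `0` is complete. -/
theorem exists_tendsto {a : ℕ → GradedCompletion F γ} (h₀ : ∀ n, a n ∈ component F γ 0)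
    (ha : ∀ n, a (n + 1) - a n ∈ tail γ F n) :
    ∃ x ∈ component F γ 0, Tendsto a atTop (𝓝 x) := by
  have h := (continuous_subtype_val.tendsto _).comp (tendsto_zero_of_mem_tail ha)
  have hc : CauchySeq fun n => (a n : UniformSpace.Completion (Leavitt F γ)) :=
    NonarchimedeanAddGroup.cauchySeq_of_tendsto_sub_nhds_zero h
  obtain ⟨x, hx⟩ := cauchySeq_tendsto_of_complete hc
  have hx0 : x ∈ closedComponent F γ 0 :=
    (Submodule.isClosed_topologicalClosure _).mem_of_tendsto hx (Eventually.of_forall h₀)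
  exact ⟨⟨x, Submodule.mem_iSup_of_mem 0 hx0⟩, hx0, tendsto_subtype_rng.2 hx⟩

end GradedCompletion

end DirGraph

end

noncomputable section

namespace DirGraph

open Leavitt

variable {F : Type*} [Field F] {V E : Type*} {Γ : DirGraph V E}

/-! ### The paths `g_v(n)` -/

namespace Specialization

variable (γ : Γ.Specialization)

theorem specialPath_succ_of_nonSink {v : V} {n : ℕ} (h : Γ.NonSink (γ.specialPath v n).range) :
    γ.specialPath v (n + 1) =
      (γ.specialPath v n).snoc (γ.edge ⟨_, h⟩) (γ.s_edge ⟨_, h⟩) := dif_pos h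

theorem specialPath_succ_of_sink {v : V} {n : ℕ} (h : ¬ Γ.NonSink (γ.specialPath v n).range) :
    γ.specialPath v (n + 1) = γ.specialPath v n := dif_neg h

theorem specialPath_src (v : V) (n : ℕ) : (γ.specialPath v n).src = v := by
  induction n with
  | zero => rfl
  | succ n ih =>
    by_cases h : Γ.NonSink (γ.specialPath v n).range
    · rw [specialPath_succ_of_nonSink γ h]; exact ih
    · rw [specialPath_succ_of_sink γ h]; exact ih

theorem isSpecial_of_mem_specialPath (v : V) (n : ℕ) :
    ∀ e ∈ (γ.specialPath v n).edges, γ.IsSpecial e := by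
  induction n with
  | zero => simp [specialPath, Path.nil]
  | succ n ih =>
    by_cases h : Γ.NonSink (γ.specialPath v n).range
    · rw [specialPath_succ_of_nonSink γ h]
      simp only [Path.snoc, List.mem_append, List.mem_singleton]
      rintro e (he | rfl)
      · exact ih e he
      · exact γ.isSpecial_edge _
    · rw [specialPath_succ_of_sink γ h]; exact ih

theorem length_specialPath {v : V} {n : ℕ} (h : Γ.NonSink (γ.specialPath v n).range) :
    (γ.specialPath v n).length = n := by
  induction n with
  | zero => rfl
  | succ n ih =>
    by_cases h' : Γ.NonSink (γ.specialPath v n).range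
    · rw [specialPath_succ_of_nonSink γ h']
      have := ih h'
      simp only [Path.length] at this
      simp [Path.snoc, Path.length, this]
    · rw [specialPath_succ_of_sink γ h'] at h
      exact absurd h h'

theorem specialPath_succ {e : E} (he : γ.IsSpecial e) (n : ℕ) :
    γ.specialPath (Γ.s e) (n + 1) =
      (γ.specialPath (Γ.r e) n).cons e (γ.specialPath_src _ _) := by
  induction n with
  | zero =>
    have h : Γ.NonSink (γ.specialPath (Γ.s e) 0).range := ⟨e, rfl⟩
    rw [specialPath_succ_of_nonSink γ h]
    refine Path.ext_of_edges rfl ?_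
    change [γ.edge _] = [e]
    rw [← he.eq_edge]
    rfl
  | succ n ih =>
    have hr : (γ.specialPath (Γ.s e) (n + 1)).range = (γ.specialPath (Γ.r e) n).range := by
      rw [ih, Path.range_cons]
    by_cases h : Γ.NonSink (γ.specialPath (Γ.r e) n).range
    · have h' := hr ▸ h
      rw [specialPath_succ_of_nonSink γ h']
      refine Path.ext_of_edges (γ.specialPath_src _ _) ?_
      change (γ.specialPath (Γ.s e) (n + 1)).edges ++ [γ.edge ⟨_, h'⟩] =
        e :: (γ.specialPath (Γ.r e) (n + 1)).edges
      rw [specialPath_succ_of_nonSink γ h,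
        show γ.edge ⟨_, h'⟩ = γ.edge ⟨_, h⟩ from congrArg γ.edge (Subtype.ext hr), ih]
      rfl
    · have h' := hr ▸ h
      rw [specialPath_succ_of_sink γ h', ih]
      simp only [specialPath_succ_of_sink γ h]

end Specialization

variable [Fintype V] [Fintype E]

namespace Leavitt

variable (γ : Γ.Specialization)

theorem listElt_mul_edge_mul_ghost_mul_listStar (p q : Γ.Path) (e : E) (hp : Γ.s e = p.range)
    (hq : Γ.s e = q.range) :
    listElt F γ p.src p.edges * (edge F γ e * ghost F γ e) * listStar F γ q.src q.edges =
      mon F γ (p.snoc e hp) (q.snoc e hq) := by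
  have h1 := listElt_append (F := F) γ p.src p.edges [e] p.isPath
  have h2 := listStar_append (F := F) γ q.src q.edges [e] q.isPath
  simp only [mon, Path.snoc]
  rw [← h1, ← h2, ← show Γ.s e = Γ.endFrom p.src p.edges from hp,
    ← show Γ.s e = Γ.endFrom q.src q.edges from hq]
  simp only [listElt, listStar, List.map_cons, List.map_nil, List.prod_cons, List.prod_nil, mul_one,
    List.reverse_cons, List.reverse_nil, List.nil_append, source_edge, ghost_source, mul_assoc]

theorem listStar_mul_listElt_self (v : V) (l : List E) (hl : Γ.IsPathFrom v l) :
    listStar F γ v l * listElt F γ v l = vert F γ (Γ.endFrom v l) := by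
  induction l generalizing v with
  | nil => simp [listElt, listStar, endFrom, vert_vert]
  | cons e l ih =>
    obtain ⟨rfl, hl⟩ := hl
    rw [listElt_cons, listStar_cons, mul_assoc, ← mul_assoc (ghost F γ e), ghost_edge,
      ← mul_assoc, endFrom, ← ih _ hl]
    congr 1
    simp [listStar, mul_assoc, vert_vert]

theorem mon_mul_mon_swap {p q : Γ.Path} (h : p.range = q.range) :
    mon F γ q p * mon F γ p q = mon F γ q q := by
  rw [mon, mon, mul_assoc, ← mul_assoc (listStar F γ _ _),
    listStar_mul_listElt_self γ _ _ p.isPath, show Γ.endFrom p.src p.edges =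
      Γ.endFrom q.src q.edges from h, end_mul_listStar γ _ _ q.isPath, mon]

end Leavitt

/-! ### The idempotents `e_v` -/

namespace GradedCompletion

variable (γ : Γ.Specialization)

/-- An edge as an element of the graded completion. -/
def edge (F : Type*) [Field F] (e : E) : GradedCompletion F γ := of γ (Leavitt.edge F γ e)

/-- A ghost edge as an element of the graded completion. -/
def ghost (F : Type*) [Field F] (e : E) : GradedCompletion F γ := of γ (Leavitt.ghost F γ e)

variable {γ}

theorem mon_mem_component (p q : Γ.Path) : mon F γ p q ∈ component F γ (p.length - q.length) :=
  of_mem_component γ (Submodule.subset_span ⟨p, q, rfl, rfl⟩)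

theorem mon_self_mem_component (p : Γ.Path) : mon F γ p p ∈ component F γ 0 := by
  simpa using mon_mem_component (F := F) (γ := γ) p p

theorem mon_snoc_sub_mem_tail (p : Γ.Path) (e : E) (he : γ.IsSpecial e) (h : Γ.s e = p.range)
    {m : ℕ} (hm : m ≤ p.length) :
    mon F γ p p - mon F γ (p.snoc e h) (p.snoc e h) ∈ tail γ F m := by
  classical
  have h1 : Leavitt.mon F γ p p = ∑ f with Γ.s f = p.range, listElt F γ p.src p.edges *
      (Leavitt.edge F γ f * Leavitt.ghost F γ f) * listStar F γ p.src p.edges := by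
    rw [← Finset.sum_mul, ← Finset.mul_sum, ← Leavitt.sum_edge_ghost γ p.range ⟨e, h⟩]
    rw [Path.range, listElt_mul_end γ _ _ p.isPath, Leavitt.mon]
  have hmem : e ∈ Finset.univ.filter fun f => Γ.s f = p.range := by simp [h]
  rw [← Finset.add_sum_erase _ _ hmem, listElt_mul_edge_mul_ghost_mul_listStar γ p p e h h] at h1
  rw [← of_mon, h1, map_add, of_mon, add_sub_cancel_left, map_sum]
  refine Submodule.sum_mem _ fun f hf => ?_
  obtain ⟨hne, hf⟩ := Finset.mem_erase.1 hf
  have hf : Γ.s f = p.range := by simpa using hf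
  have hfs : ¬ γ.IsSpecial f := fun hfs => hne (hfs.eq_of_s_eq he (hf.trans h.symm))
  rw [listElt_mul_edge_mul_ghost_mul_listStar γ p p f hf hf]
  exact mon_mem_tail ⟨_, _, rfl, hfs⟩ ⟨_, _, rfl, hfs⟩ rfl
    (by
      simp only [Path.length, Path.snoc, List.length_append, List.length_singleton] at hm ⊢
      omega)

theorem specialPath_sub_mem_tail (v : V) (n : ℕ) :
    mon F γ (γ.specialPath v n) (γ.specialPath v n) -
      mon F γ (γ.specialPath v (n + 1)) (γ.specialPath v (n + 1)) ∈ tail γ F n := by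
  by_cases h : Γ.NonSink (γ.specialPath v n).range
  · rw [γ.specialPath_succ_of_nonSink h]
    exact mon_snoc_sub_mem_tail _ _ (γ.isSpecial_edge _) _ (γ.length_specialPath h).ge
  · rw [γ.specialPath_succ_of_sink h, sub_self]
    exact zero_mem _

theorem tendsto_specialIdempotent_and_mem_component (v : V) :
    Tendsto (fun n => mon F γ (γ.specialPath v n) (γ.specialPath v n)) atTop
      (𝓝 (specialIdempotent F γ v)) ∧ specialIdempotent F γ v ∈ component F γ 0 := by
  obtain ⟨x, hx, h⟩ := exists_tendsto (F := F) (γ := γ)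
    (a := fun n => mon F γ (γ.specialPath v n) (γ.specialPath v n))
    (fun n => mon_self_mem_component _)
    (fun n => by rw [← neg_sub]; exact neg_mem (specialPath_sub_mem_tail v n))
  rw [specialIdempotent, h.limUnder_eq]
  exact ⟨h, hx⟩

theorem tendsto_specialIdempotent (v : V) :
    Tendsto (fun n => mon F γ (γ.specialPath v n) (γ.specialPath v n)) atTop
      (𝓝 (specialIdempotent F γ v)) := (tendsto_specialIdempotent_and_mem_component v).1

theorem specialIdempotent_mem_component (v : V) : specialIdempotent F γ v ∈ component F γ 0 :=
  (tendsto_specialIdempotent_and_mem_component v).2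

theorem specialIdempotent_mul_self (v : V) :
    specialIdempotent F γ v * specialIdempotent F γ v = specialIdempotent F γ v := by
  refine tendsto_nhds_unique ((tendsto_specialIdempotent v).mul (tendsto_specialIdempotent v)) ?_
  refine (tendsto_specialIdempotent v).congr fun n => ?_
  simp only [← of_mon, ← map_mul, mon_mul_mon_swap]

theorem vert_mul_specialIdempotent (v : V) :
    vert F γ v * specialIdempotent F γ v = specialIdempotent F γ v := by
  refine tendsto_nhds_unique ((tendsto_specialIdempotent v).const_mul _) ?_
  refine (tendsto_specialIdempotent v).congr fun n => ?_
  have := vert_mul_mon (F := F) γ (γ.specialPath v n) (γ.specialPath v n)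
  rw [γ.specialPath_src] at this
  rw [← of_mon, ← of_vert, ← map_mul, this]

theorem specialIdempotent_mul_vert (v : V) :
    specialIdempotent F γ v * vert F γ v = specialIdempotent F γ v := by
  refine tendsto_nhds_unique ((tendsto_specialIdempotent v).mul_const _) ?_
  refine (tendsto_specialIdempotent v).congr fun n => ?_
  have := mon_mul_vert (F := F) γ (γ.specialPath v n) (γ.specialPath v n)
  rw [γ.specialPath_src] at this
  rw [← of_mon, ← of_vert, ← map_mul, this]

theorem vert_eq_mon (v : V) : vert F γ v = mon F γ (Path.nil Γ v) (Path.nil Γ v) := by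
  rw [← of_vert, Leavitt.vert_eq_mon, of_mon]

/-- The recursion for the idempotents: `e_{s(e)} = e e_{r(e)} e^*` for a special edge `e`. -/
theorem specialIdempotent_source {e : E} (he : γ.IsSpecial e) :
    specialIdempotent F γ (Γ.s e) = edge γ F e * specialIdempotent F γ (Γ.r e) * ghost γ F e := by
  refine tendsto_nhds_unique ((tendsto_add_atTop_iff_nat 1).2 (tendsto_specialIdempotent _)) ?_
  refine (((tendsto_specialIdempotent (Γ.r e)).const_mul _).mul_const _).congr fun n => ?_
  rw [γ.specialPath_succ he, ← of_mon, ← of_mon, edge, ghost, ← map_mul, ← map_mul,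
    edge_mul_mon_mul_ghost γ e]

theorem ghost_mul_edge (e : E) : ghost γ F e * edge γ F e = vert F γ (Γ.r e) := by
  rw [ghost, edge, ← map_mul, ghost_edge, of_vert]

theorem ghost_mul_edge_of_ne {e f : E} (h : e ≠ f) : ghost γ F e * edge γ F f = 0 := by
  rw [ghost, edge, ← map_mul, ghost_edge_ne γ h, map_zero]

theorem specialIdempotent_range {e : E} (he : γ.IsSpecial e) :
    specialIdempotent F γ (Γ.r e) = ghost γ F e * specialIdempotent F γ (Γ.s e) * edge γ F e := by
  rw [specialIdempotent_source he]
  simp only [mul_assoc, ghost_mul_edge, specialIdempotent_mul_vert]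
  rw [← mul_assoc, ghost_mul_edge, vert_mul_specialIdempotent]

open Classical in
theorem specialIdempotent_mul_edge (e : E) : specialIdempotent F γ (Γ.s e) * edge γ F e =
    if γ.IsSpecial e then edge γ F e * specialIdempotent F γ (Γ.r e) else 0 := by
  split_ifs with he
  · rw [specialIdempotent_source he, mul_assoc, ghost_mul_edge, mul_assoc,
      specialIdempotent_mul_vert]
  · have h := γ.isSpecial_edge ⟨Γ.s e, e, rfl⟩
    have hs : Γ.s (γ.edge ⟨Γ.s e, e, rfl⟩) = Γ.s e := γ.s_edge _
    have := specialIdempotent_source (F := F) h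
    rw [hs] at this
    rw [this, mul_assoc, ghost_mul_edge_of_ne, mul_zero]
    rintro h'
    exact he (h' ▸ h)

open Classical in
theorem ghost_mul_specialIdempotent (e : E) : ghost γ F e * specialIdempotent F γ (Γ.s e) =
    if γ.IsSpecial e then specialIdempotent F γ (Γ.r e) * ghost γ F e else 0 := by
  split_ifs with he
  · rw [specialIdempotent_source he, ← mul_assoc, ← mul_assoc, ghost_mul_edge,
      vert_mul_specialIdempotent]
  · have h := γ.isSpecial_edge ⟨Γ.s e, e, rfl⟩
    have hs : Γ.s (γ.edge ⟨Γ.s e, e, rfl⟩) = Γ.s e := γ.s_edge _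
    have := specialIdempotent_source (F := F) h
    rw [hs] at this
    rw [this, ← mul_assoc, ← mul_assoc, ghost_mul_edge_of_ne, zero_mul, zero_mul]
    rintro h'
    exact he (h' ▸ h)

open Classical in
theorem specialIdempotent_mul_listElt (v : V) (l : List E) (hl : Γ.IsPathFrom v l) :
    specialIdempotent F γ v * of γ (listElt F γ v l) =
      if ∀ e ∈ l, γ.IsSpecial e then
        of γ (listElt F γ v l) * specialIdempotent F γ (Γ.endFrom v l) else 0 := by
  induction l generalizing v with
  | nil => simp [listElt, of_vert, endFrom, specialIdempotent_mul_vert, vert_mul_specialIdempotent]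
  | cons e l ih =>
    obtain ⟨rfl, hl⟩ := hl
    rw [listElt_cons, map_mul, ← edge, ← mul_assoc, specialIdempotent_mul_edge]
    by_cases he : γ.IsSpecial e
    · rw [if_pos he, mul_assoc, ih _ hl]
      simp only [endFrom, List.mem_cons, forall_eq_or_imp, he, true_and]
      split_ifs
      · rw [mul_assoc]
      · rw [mul_zero]
    · simp [he]

open Classical in
theorem listStar_mul_specialIdempotent (v : V) (l : List E) (hl : Γ.IsPathFrom v l) :
    of γ (listStar F γ v l) * specialIdempotent F γ v =
      if ∀ e ∈ l, γ.IsSpecial e then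
        specialIdempotent F γ (Γ.endFrom v l) * of γ (listStar F γ v l) else 0 := by
  induction l generalizing v with
  | nil => simp [listStar, of_vert, endFrom, specialIdempotent_mul_vert, vert_mul_specialIdempotent]
  | cons e l ih =>
    obtain ⟨rfl, hl⟩ := hl
    rw [listStar_cons, map_mul, ← ghost, mul_assoc, ghost_mul_specialIdempotent]
    by_cases he : γ.IsSpecial e
    · rw [if_pos he, ← mul_assoc, ih _ hl]
      simp only [endFrom, List.mem_cons, forall_eq_or_imp, he, true_and]
      split_ifs
      · rw [mul_assoc]
      · rw [zero_mul]
    · simp [he]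

theorem specialIdempotent_mul_vert_of_ne {v w : V} (h : v ≠ w) :
    specialIdempotent F γ v * vert F γ w = 0 := by
  rw [← specialIdempotent_mul_vert, mul_assoc, ← of_vert, ← of_vert, ← map_mul, vert_vert_ne γ h,
    map_zero, mul_zero]

theorem vert_mul_specialIdempotent_of_ne {v w : V} (h : w ≠ v) :
    vert F γ w * specialIdempotent F γ v = 0 := by
  rw [← vert_mul_specialIdempotent, ← mul_assoc, ← of_vert, ← of_vert, ← map_mul, vert_vert_ne γ h,
    map_zero, zero_mul]

/-- Unless `p` is a special path from `v`, the idempotent `e_v` annihilates `p q^*`. -/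
theorem special_of_specialIdempotent_mul_mon_ne_zero {v : V} {p q : Γ.Path}
    (h : specialIdempotent F γ v * mon F γ p q ≠ 0) :
    p.src = v ∧ ∀ e ∈ p.edges, γ.IsSpecial e := by
  classical
  have hsrc : p.src = v := by
    by_contra hne
    apply h
    rw [← of_mon, ← vert_mul_mon, map_mul, of_vert, ← mul_assoc,
      specialIdempotent_mul_vert_of_ne (Ne.symm hne), zero_mul]
  refine ⟨hsrc, ?_⟩
  by_contra hs
  apply h
  rw [← of_mon, Leavitt.mon, map_mul, ← hsrc, ← mul_assoc,
    specialIdempotent_mul_listElt _ _ p.isPath, if_neg hs, zero_mul]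

theorem special_of_mon_mul_specialIdempotent_ne_zero {v : V} {p q : Γ.Path}
    (h : mon F γ p q * specialIdempotent F γ v ≠ 0) :
    q.src = v ∧ ∀ e ∈ q.edges, γ.IsSpecial e := by
  classical
  have hsrc : q.src = v := by
    by_contra hne
    apply h
    rw [← of_mon, ← mon_mul_vert, map_mul, of_vert, mul_assoc,
      vert_mul_specialIdempotent_of_ne hne, mul_zero]
  refine ⟨hsrc, ?_⟩
  by_contra hs
  apply h
  rw [← of_mon, Leavitt.mon, map_mul, ← hsrc, mul_assoc,
    listStar_mul_specialIdempotent _ _ q.isPath, if_neg hs, mul_zero]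

theorem range_eq_of_mon_ne_zero {p q : Γ.Path} (h : mon F γ p q ≠ 0) : p.range = q.range := by
  by_contra hne
  exact h (by rw [← of_mon, mon_eq_zero γ hne, map_zero])

/-- A special `p q^*` intertwines the idempotents at the sources of `p` and `q`. -/
theorem specialIdempotent_mul_mon {p q : Γ.Path} (hp : ∀ e ∈ p.edges, γ.IsSpecial e)
    (hq : ∀ e ∈ q.edges, γ.IsSpecial e) (h : p.range = q.range) :
    specialIdempotent F γ p.src * mon F γ p q = mon F γ p q * specialIdempotent F γ q.src := by
  classical
  have h1 := specialIdempotent_mul_listElt (F := F) (γ := γ) _ _ p.isPath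
  have h2 := listStar_mul_specialIdempotent (F := F) (γ := γ) _ _ q.isPath
  rw [if_pos hp] at h1
  rw [if_pos hq] at h2
  rw [← of_mon, Leavitt.mon, map_mul, ← mul_assoc, h1, mul_assoc, mul_assoc, h2]
  rw [show Γ.endFrom p.src p.edges = Γ.endFrom q.src q.edges from h]

/-- `e_v p p^* = e_v` for a special path `p` from `v`. -/
theorem specialIdempotent_mul_mon_self {p : Γ.Path} (hp : ∀ e ∈ p.edges, γ.IsSpecial e) :
    specialIdempotent F γ p.src * mon F γ p p = specialIdempotent F γ p.src := by
  obtain ⟨v, l, hl⟩ := p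
  induction l generalizing v with
  | nil => exact (congrArg _ (vert_eq_mon v).symm).trans (specialIdempotent_mul_vert v)
  | cons e l ih =>
    obtain ⟨rfl, hl⟩ := hl
    have he : γ.IsSpecial e := hp e (by simp)
    have := edge_mul_mon_mul_ghost (F := F) γ e ⟨Γ.r e, l, hl⟩ ⟨Γ.r e, l, hl⟩ rfl rfl
    have hm : mon F γ ⟨Γ.s e, e :: l, rfl, hl⟩ ⟨Γ.s e, e :: l, rfl, hl⟩ =
        edge γ F e * mon F γ ⟨Γ.r e, l, hl⟩ ⟨Γ.r e, l, hl⟩ * ghost γ F e := by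
      rw [edge, ghost, ← of_mon, ← of_mon, ← map_mul, ← map_mul, this]
      rfl
    have hi := ih _ hl fun f hf => hp f (by simp_all)
    simp only at hi ⊢
    rw [hm, specialIdempotent_source he]
    rw [show ∀ a b c d f : GradedCompletion F γ, a * b * c * (d * f * c) = a * (b * (c * d) * f) * c
      from fun a b c d f => by simp only [mul_assoc], ghost_mul_edge,
      specialIdempotent_mul_vert, hi]

/-- The idempotents of distinct components are separated by the whole algebra. -/
theorem specialIdempotent_mul_mul_specialIdempotent {v w : V}
    (h : γ.undirected.connectedComponentMk v ≠ γ.undirected.connectedComponentMk w)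
    (x : GradedCompletion F γ) : specialIdempotent F γ v * x * specialIdempotent F γ w = 0 := by
  refine (Submodule.mem_bot F).1 (mul_mul_mem γ isClosed_singleton (fun p q => ?_) x)
  rw [Submodule.mem_bot]
  by_contra hne
  obtain ⟨h1, hp⟩ := special_of_specialIdempotent_mul_mon_ne_zero (left_ne_zero_of_mul hne)
  rw [mul_assoc] at hne
  have h0 := right_ne_zero_of_mul hne
  obtain ⟨h2, hq⟩ := special_of_mon_mul_specialIdempotent_ne_zero h0
  have h3 := range_eq_of_mon_ne_zero (left_ne_zero_of_mul h0)
  have e1 := γ.connectedComponentMk_endFrom p.isPath hp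
  have e2 := γ.connectedComponentMk_endFrom q.isPath hq
  apply h
  rw [← h1, ← h2, ← e1, ← e2]
  exact congrArg _ h3

/-- If `W` is hereditary and `u` is in a component which does not meet `W`, the idempotent `e_u` is
separated from the vertices in `W` by the whole algebra. -/
theorem specialIdempotent_mul_mul_vert {u w : V} {W : Set V} (hW : Γ.IsHereditary W) (hw : w ∈ W)
    (h : ∀ v ∈ W, γ.undirected.connectedComponentMk v ≠ γ.undirected.connectedComponentMk u)
    (x : GradedCompletion F γ) : specialIdempotent F γ u * x * vert F γ w = 0 := by
  refine (Submodule.mem_bot F).1 (mul_mul_mem γ isClosed_singleton (fun p q => ?_) x)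
  rw [Submodule.mem_bot]
  by_contra hne
  obtain ⟨h1, hp⟩ := special_of_specialIdempotent_mul_mon_ne_zero (left_ne_zero_of_mul hne)
  rw [mul_assoc] at hne
  have h0 := right_ne_zero_of_mul hne
  have h2 : q.src = w := by
    by_contra h2
    exact h0 (by rw [← of_mon, ← of_vert, ← map_mul, mon_mul_vert_of_ne γ h2, map_zero])
  have h3 := range_eq_of_mon_ne_zero (left_ne_zero_of_mul h0)
  refine h p.range ?_ ((γ.connectedComponentMk_endFrom p.isPath hp).trans (by rw [h1]))
  rw [h3]
  exact hW.2 w hw _ ⟨q, h2, rfl⟩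

/-! ### The spaces `e_v L̂ e_w` -/

/-- The neighbourhood of `0` given by `V_1` meets the line `F e_v` in `0` only. -/
theorem smul_specialIdempotent_mem_closure {v : V} {c : F}
    (h : c • specialIdempotent F γ v ∈ closure (of γ '' nbhd F γ 1)) : c = 0 := by
  obtain ⟨Φ⟩ := Fan.nonempty γ
  set O : Submodule F (GradedCompletion F γ) :=
    ((nbhd F γ 1).map (of γ).toLinearMap).topologicalClosure
  have hO : (O : Set (GradedCompletion F γ)) ∈ 𝓝 0 := by
    exact (hasBasis_nhds_zero (F := F) γ).mem_of_mem (i := 0) trivial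
  have ht : Tendsto (fun n => c • mon F γ (γ.specialPath v n) (γ.specialPath v n) -
      c • specialIdempotent F γ v) atTop (𝓝 0) := by
    simpa using ((tendsto_specialIdempotent v).const_smul c).sub_const
      (c • specialIdempotent F γ v)
  obtain ⟨n, hn⟩ := (ht.eventually_mem hO).exists
  have h1 : c • mon F γ (γ.specialPath v n) (γ.specialPath v n) ∈ O := by
    simpa using add_mem hn (show c • specialIdempotent F γ v ∈ O from h)
  rw [← of_mon, ← map_smul] at h1
  have h2 : c • Leavitt.mon F γ (γ.specialPath v n) (γ.specialPath v n) ∈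
      closure (nbhd F γ 1 : Set (Leavitt F γ)) := by
    rw [(isInducing_of γ).closure_eq_preimage_closure_image]
    exact h1
  have hopen : IsOpen ((nbhd F γ 1).toAddSubgroup : Set (Leavitt F γ)) :=
    ((ringSubgroupsBasis (F := F) γ).openAddSubgroup 0).isOpen'
  have hcl : IsClosed (nbhd F γ 1 : Set (Leavitt F γ)) :=
    AddSubgroup.isClosed_of_isOpen (nbhd F γ 1).toAddSubgroup hopen
  rw [hcl.closure_eq] at h2
  have h3 := Φ.coeff_eq_zero_of_mem_nbhd v h2
  have h4 := Φ.coeff_mon_self (F := F) (γ.specialPath v n) (γ.isSpecial_of_mem_specialPath v n)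
  rw [γ.specialPath_src] at h4
  simpa [h4] using h3

theorem specialIdempotent_ne_zero (v : V) : specialIdempotent F γ v ≠ 0 := by
  intro h
  refine one_ne_zero (smul_specialIdempotent_mem_closure (F := F) (γ := γ) (v := v) (c := 1) ?_)
  rw [h, smul_zero]
  exact subset_closure ⟨0, zero_mem _, map_zero _⟩

/-- The line `F e_v` is closed, because it is discrete. -/
theorem isClosed_span_specialIdempotent (v : V) :
    IsClosed (Submodule.span F {specialIdempotent F γ v} : Set (GradedCompletion F γ)) := by
  set H : AddSubgroup (GradedCompletion F γ) :=
    (Submodule.span F {specialIdempotent F γ v}).toAddSubgroup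
  have hO : closure (of γ '' nbhd F γ 1) ∈ 𝓝 (0 : GradedCompletion F γ) :=
    (hasBasis_nhds_zero (F := F) γ).mem_of_mem (i := 0) trivial
  obtain ⟨U, hU, hUo, h0⟩ := mem_nhds_iff.1 hO
  have : DiscreteTopology H := by
    rw [discreteTopology_iff_isOpen_singleton_zero]
    convert! hUo.preimage (continuous_subtype_val (p := (· ∈ H)))
    ext ⟨x, hx⟩
    obtain ⟨c, rfl⟩ := Submodule.mem_span_singleton.1 hx
    simp only [Set.mem_singleton_iff, Set.mem_preimage]
    constructor
    · intro h
      rw [Subtype.ext_iff] at h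
      change c • specialIdempotent F γ v = 0 at h
      rwa [h]
    · intro h
      have hc := smul_specialIdempotent_mem_closure (hU h)
      subst hc
      ext1
      simp
  exact H.isClosed_of_discrete

/-- A nonzero homogeneous element of `e_v L̂ e_w` is invertible up to the idempotents. -/
theorem exists_mul_eq_specialIdempotent {v w : V} {i : ℤ} {x : GradedCompletion F γ}
    (hx : x ∈ component F γ i) (h : specialIdempotent F γ v * x * specialIdempotent F γ w ≠ 0) :
    ∃ z, specialIdempotent F γ v * x * specialIdempotent F γ w * z = specialIdempotent F γ v := by
  have key : ∃ p q : Γ.Path, (p.length : ℤ) - q.length = i ∧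
      specialIdempotent F γ v * mon F γ p q * specialIdempotent F γ w ≠ 0 := by
    by_contra! hall
    exact h ((Submodule.mem_bot F).1 (mul_mul_mem_of_mem_component γ isClosed_singleton
      (fun p q hpq => (Submodule.mem_bot F).2 (hall p q hpq)) hx))
  obtain ⟨p, q, hpq, hne⟩ := key
  obtain ⟨rfl, hp⟩ := special_of_specialIdempotent_mul_mon_ne_zero (left_ne_zero_of_mul hne)
  rw [mul_assoc] at hne
  have h0 := right_ne_zero_of_mul hne
  obtain ⟨rfl, hq⟩ := special_of_mon_mul_specialIdempotent_ne_zero h0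
  have hr := range_eq_of_mon_ne_zero (left_ne_zero_of_mul h0)
  set b := mon F γ q p * specialIdempotent F γ p.src with hb
  have hwb : specialIdempotent F γ q.src * b = b := by
    rw [hb, ← mul_assoc, specialIdempotent_mul_mon hq hp hr.symm, mul_assoc,
      specialIdempotent_mul_self]
  -- `b` lowers the degree to `0`, where `e_v L(Γ) e_v` is the line spanned by `e_v`.
  have hmem : specialIdempotent F γ p.src * x * b ∈
      Submodule.span F {specialIdempotent F γ p.src} := by
    refine mul_mul_mem_of_mem_component γ (isClosed_span_specialIdempotent _)
      (fun p₂ q₂ h₂ => ?_) hx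
    rw [hb, mul_assoc, ← mul_assoc (mon F γ p₂ q₂), ← of_mon, ← of_mon, ← map_mul]
    rcases mon_mul_mon (F := F) γ p₂ q₂ q p with h3 | ⟨p₃, q₃, h3, hd, -⟩
    · simp [h3]
    · rw [h3, of_mon]
      by_cases hz : specialIdempotent F γ p.src *
          (mon F γ p₃ q₃ * specialIdempotent F γ p.src) = 0
      · rw [hz]; exact zero_mem _
      obtain ⟨h4, h4'⟩ := special_of_mon_mul_specialIdempotent_ne_zero (right_ne_zero_of_mul hz)
      rw [← mul_assoc] at hz
      obtain ⟨h5, h5'⟩ := special_of_specialIdempotent_mul_mon_ne_zero (left_ne_zero_of_mul hz)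
      have h6 : p₃ = q₃ := by
        refine Path.ext_of_edges (h5.trans h4.symm) ?_
        refine γ.eq_of_forall_isSpecial p₃.isPath ?_ h5' h4' ?_
        · rw [h5, ← h4]; exact q₃.isPath
        · simp only [Path.length] at hd h₂ hpq
          omega
      subst h6
      rw [← mul_assoc, ← h5, specialIdempotent_mul_mon_self h5', specialIdempotent_mul_self]
      exact Submodule.mem_span_singleton_self _
  obtain ⟨c, hc⟩ := Submodule.mem_span_singleton.1 hmem
  have hback : specialIdempotent F γ q.src * (b * mon F γ p q) = specialIdempotent F γ q.src := by
    rw [hb, mul_assoc, specialIdempotent_mul_mon hp hq hr, ← mul_assoc (mon F γ q p), ← of_mon,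
      ← of_mon, ← map_mul, mon_mul_mon_swap γ hr, of_mon, ← mul_assoc,
      specialIdempotent_mul_mon_self hq, specialIdempotent_mul_self]
  have hc0 : c ≠ 0 := by
    rintro rfl
    rw [zero_smul] at hc
    apply h
    rw [← hback, ← mul_assoc, ← mul_assoc, mul_assoc _ _ b, hwb, ← hc, zero_mul]
  refine ⟨c⁻¹ • b, ?_⟩
  rw [mul_smul_comm, mul_assoc, hwb, ← hc, smul_smul, inv_mul_cancel₀ hc0, one_smul]

end GradedCompletion

end DirGraph

end

noncomputable section

namespace DirGraph

open Leavitt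

variable {F : Type*} [Field F] {V E : Type*} {Γ : DirGraph V E}

variable [Fintype V] [Fintype E]

namespace GradedCompletion

variable {γ : Γ.Specialization}

/-! ### The pushforward operator -/

theorem vert_sub_specialIdempotent_mem_tail (v : V) :
    vert F γ v - specialIdempotent F γ v ∈ tail γ F 0 := by
  refine (isClosed_tail 0).mem_of_tendsto ((tendsto_specialIdempotent v).const_sub _)
    (Eventually.of_forall fun n => ?_)
  induction n with
  | zero => rw [vert_eq_mon]; exact (sub_self (mon F γ _ _)).symm ▸ zero_mem _
  | succ n ih =>
    simpa using add_mem ih (tail_anti (Nat.zero_le n) (specialPath_sub_mem_tail (F := F) v n))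

theorem edge_mul_mul_ghost_mem_tail {m : ℕ} (e : E) {z : GradedCompletion F γ}
    (hz : z ∈ tail γ F m) : edge γ F e * z * ghost γ F e ∈ tail γ F (m + 1) := by
  have hc : Continuous fun z : GradedCompletion F γ => edge γ F e * z * ghost γ F e :=
    (continuous_const.mul continuous_id).mul continuous_const
  have hle : tail γ F m ≤
      (tail γ F (m + 1)).comap (LinearMap.mulLeftRight F (edge γ F e, ghost γ F e)) := by
    refine Submodule.topologicalClosure_minimal _ (Submodule.span_le.2 ?_)
      ((isClosed_tail (m + 1)).preimage hc)
    rintro _ ⟨p, q, rfl, hp, hq, hl, hm⟩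
    change edge γ F e * mon F γ p q * ghost γ F e ∈ tail γ F (m + 1)
    rw [edge, ghost, ← of_mon, ← map_mul, ← map_mul]
    by_cases h1 : p.src = Γ.r e
    · by_cases h2 : q.src = Γ.r e
      · rw [edge_mul_mon_mul_ghost γ e p q h1 h2]
        obtain ⟨l, f, hl', hf⟩ := hp
        obtain ⟨t, g, ht', hg⟩ := hq
        refine mon_mem_tail ⟨e :: l, f, by simp [Path.cons, hl'], hf⟩
          ⟨e :: t, g, by simp [Path.cons, ht'], hg⟩ ?_ ?_ <;>
        · simp only [Path.length, Path.cons, List.length_cons] at hl hm ⊢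
          omega
      · rw [← range_ghost, mul_assoc, ← mul_assoc (Leavitt.mon F γ p q), mon_mul_vert_of_ne γ h2]
        simp
    · rw [← edge_range, mul_assoc (Leavitt.edge F γ e), vert_mul_mon_of_ne γ (Ne.symm h1)]
      simp
  exact hle hz

theorem vert_mul_mul_vert_eq_zero {m : ℕ} {v : V} (hv : ¬ Γ.NonSink v) {z : GradedCompletion F γ}
    (hz : z ∈ tail γ F m) : vert F γ v * z * vert F γ v = 0 := by
  have hc : Continuous fun z : GradedCompletion F γ => vert F γ v * z * vert F γ v :=
    (continuous_const.mul continuous_id).mul continuous_const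
  have hle : tail γ F m ≤
      (⊥ : Submodule F _).comap (LinearMap.mulLeftRight F (vert F γ v, vert F γ v)) := by
    refine Submodule.topologicalClosure_minimal _ (Submodule.span_le.2 ?_)
      (isClosed_singleton.preimage hc)
    rintro _ ⟨p, q, rfl, ⟨l, f, hl, hf⟩, -⟩
    change vert F γ v * mon F γ p q * vert F γ v = 0
    rw [← of_mon, ← of_vert, ← map_mul, vert_mul_mon_of_ne γ, map_zero, zero_mul]
    rintro rfl
    obtain ⟨w, l', hw⟩ := p
    cases l' with
    | nil => simp at hl
    | cons e l' => exact hv ⟨e, hw.1⟩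
  exact hle hz

variable (γ) in
open Classical in
/-- The part at the vertex `v` of the operator `pushforward`. -/
def pushforwardAt (F : Type*) [Field F] (v : V) : GradedCompletion F γ →ₗ[F] GradedCompletion F γ :=
  if Γ.NonSink v then ∑ e with Γ.s e = v, LinearMap.mulLeftRight F (edge γ F e, ghost γ F e)
  else LinearMap.mulLeftRight F (vert F γ v, vert F γ v)

variable (γ) in
/-- The operator `x ↦ ∑ e x e^* + ∑ v x v`, where `e` runs through the edges and `v` through the
sinks. It fixes `1`, and it makes `∑ p x p^*` for the paths `p` of length `n` into the same sum for
the paths of length `n + 1`, if paths ending in sinks are kept. -/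
def pushforward (F : Type*) [Field F] : GradedCompletion F γ →ₗ[F] GradedCompletion F γ :=
  ∑ v, pushforwardAt γ F v

open Classical in
theorem pushforwardAt_of_nonSink {v : V} (h : Γ.NonSink v) (x : GradedCompletion F γ) :
    pushforwardAt γ F v x = ∑ e with Γ.s e = v, edge γ F e * x * ghost γ F e := by
  rw [pushforwardAt, if_pos h, LinearMap.sum_apply]
  rfl

theorem pushforwardAt_of_sink {v : V} (h : ¬ Γ.NonSink v) (x : GradedCompletion F γ) :
    pushforwardAt γ F v x = vert F γ v * x * vert F γ v := by
  rw [pushforwardAt, if_neg h]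
  rfl

theorem pushforward_apply (x : GradedCompletion F γ) :
    pushforward γ F x = ∑ v, pushforwardAt γ F v x := by
  rw [pushforward, LinearMap.sum_apply]

/-- An additive subgroup which contains all `e x e^*` and `v x v` contains the pushforward. -/
theorem pushforward_mem {S : Type*} [SetLike S (GradedCompletion F γ)]
    [AddSubmonoidClass S (GradedCompletion F γ)] {s : S} {x : GradedCompletion F γ}
    (h₁ : ∀ e, edge γ F e * x * ghost γ F e ∈ s)
    (h₂ : ∀ v, ¬ Γ.NonSink v → vert F γ v * x * vert F γ v ∈ s) : pushforward γ F x ∈ s := by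
  classical
  rw [pushforward_apply]
  refine sum_mem fun v _ => ?_
  by_cases h : Γ.NonSink v
  · rw [pushforwardAt_of_nonSink h]
    exact sum_mem fun e _ => h₁ e
  · rw [pushforwardAt_of_sink h]
    exact h₂ v h

theorem vert_mul_vert (v : V) : vert F γ v * vert F γ v = vert F γ v := by
  rw [← of_vert, ← map_mul, vert_vert]

theorem sum_vert : ∑ v, vert F γ v = 1 := by
  simp only [← of_vert]
  rw [← map_sum, Leavitt.sum_vert, map_one]

theorem pushforward_one : pushforward γ F 1 = 1 := by
  classical
  rw [pushforward_apply, ← sum_vert]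
  refine Finset.sum_congr rfl fun v _ => ?_
  rw [sum_vert]
  by_cases h : Γ.NonSink v
  · rw [pushforwardAt_of_nonSink h, ← of_vert, Leavitt.sum_edge_ghost γ v h, map_sum]
    simp [edge, ghost]
  · rw [pushforwardAt_of_sink h, mul_one, vert_mul_vert]

theorem pushforward_mem_tail {m : ℕ} {z : GradedCompletion F γ} (hz : z ∈ tail γ F m) :
    pushforward γ F z ∈ tail γ F (m + 1) :=
  pushforward_mem (fun e => edge_mul_mul_ghost_mem_tail e hz)
    fun v hv => by rw [vert_mul_mul_vert_eq_zero hv hz]; exact zero_mem _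

theorem pushforward_iterate_mem_tail {z : GradedCompletion F γ} (hz : z ∈ tail γ F 0) (n : ℕ) :
    (pushforward γ F)^[n] z ∈ tail γ F n := by
  induction n with
  | zero => exact hz
  | succ n ih => rw [Function.iterate_succ_apply']; exact pushforward_mem_tail ih

theorem vert_mem_component (v : V) : vert F γ v ∈ component F γ 0 := by
  rw [vert_eq_mon]; exact mon_self_mem_component _

theorem edge_mem_component (e : E) : edge γ F e ∈ component F γ 1 := by
  exact of_mem_component γ
    (Submodule.subset_span ⟨_, _, edge_eq_mon γ e, by simp [Path.length, Path.nil]⟩)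

theorem ghost_mem_component (e : E) : ghost γ F e ∈ component F γ (-1) := by
  exact of_mem_component γ
    (Submodule.subset_span ⟨_, _, ghost_eq_mon γ e, by simp [Path.length, Path.nil]⟩)

theorem pushforward_mem_component {x : GradedCompletion F γ} (hx : x ∈ component F γ 0) :
    pushforward γ F x ∈ component F γ 0 :=
  pushforward_mem
    (fun e => by
      simpa using component_mul γ (component_mul γ (edge_mem_component e) hx)
        (ghost_mem_component e))
    fun v _ => by
      simpa using component_mul γ (component_mul γ (vert_mem_component v) hx)
        (vert_mem_component v)

variable (γ) in
open Classical in
/-- The sum of the idempotents `e_v` for the vertices `v` of a component. -/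
def componentSum (F : Type*) [Field F] (c : γ.undirected.ConnectedComponent) :
    GradedCompletion F γ :=
  ∑ v with γ.undirected.connectedComponentMk v = c, specialIdempotent F γ v

theorem edge_mul_specialIdempotent_of_ne {e : E} {v : V} (h : Γ.r e ≠ v) :
    edge γ F e * specialIdempotent F γ v = 0 := by
  rw [← vert_mul_specialIdempotent, ← mul_assoc, edge, ← of_vert, ← map_mul,
    edge_mul_vert_of_ne γ h, map_zero, zero_mul]

open Classical in
theorem edge_mul_componentSum (e : E) (c : γ.undirected.ConnectedComponent) :
    edge γ F e * componentSum γ F c = if γ.undirected.connectedComponentMk (Γ.r e) = c then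
      edge γ F e * specialIdempotent F γ (Γ.r e) else 0 := by
  rw [componentSum, Finset.mul_sum, Finset.sum_filter, Finset.sum_eq_single (Γ.r e)]
  · intro v _ hv
    rw [edge_mul_specialIdempotent_of_ne (Ne.symm hv), ite_self]
  · simp

open Classical in
theorem vert_mul_componentSum (v : V) (c : γ.undirected.ConnectedComponent) :
    vert F γ v * componentSum γ F c = if γ.undirected.connectedComponentMk v = c then
      specialIdempotent F γ v else 0 := by
  rw [componentSum, Finset.mul_sum, Finset.sum_filter, Finset.sum_eq_single v]
  · rw [vert_mul_specialIdempotent]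
  · intro w _ hw
    rw [vert_mul_specialIdempotent_of_ne (Ne.symm hw), ite_self]
  · simp

theorem edge_mul_specialIdempotent_mul_ghost_mem_tail {e : E} (he : ¬ γ.IsSpecial e) :
    edge γ F e * specialIdempotent F γ (Γ.r e) * ghost γ F e ∈ tail γ F 0 := by
  have h1 : edge γ F e * vert F γ (Γ.r e) * ghost γ F e ∈ tail γ F 0 := by
    rw [edge, ghost, ← of_vert, ← map_mul, ← map_mul, Leavitt.vert_eq_mon,
      edge_mul_mon_mul_ghost γ e _ _ rfl rfl]
    exact mon_mem_tail ⟨[], e, rfl, he⟩ ⟨[], e, rfl, he⟩ rfl (Nat.zero_lt_succ _)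
  have h2 := tail_anti (Nat.zero_le 1)
    (edge_mul_mul_ghost_mem_tail (F := F) e (vert_sub_specialIdempotent_mem_tail (γ := γ) (Γ.r e)))
  simpa [mul_sub, sub_mul] using sub_mem h1 h2

/-- The pushforward of `∑ e_v`, over the vertices `v` of a component, is the same sum plus the terms
`e e_{r(e)} e^*` for edges `e` which are not special. -/
theorem pushforward_componentSum_sub_mem_tail (c : γ.undirected.ConnectedComponent) :
    pushforward γ F (componentSum γ F c) - componentSum γ F c ∈ tail γ F 0 := by
  classical
  nth_rw 2 [componentSum]
  rw [pushforward_apply, Finset.sum_filter, ← Finset.sum_sub_distrib]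
  refine Submodule.sum_mem _ fun v _ => ?_
  by_cases h : Γ.NonSink v
  · have hmem : γ.edge ⟨v, h⟩ ∈ Finset.univ.filter fun e => Γ.s e = v := by simp [γ.s_edge]
    have hs : Γ.s (γ.edge ⟨v, h⟩) = v := γ.s_edge _
    have hspec := γ.isSpecial_edge ⟨v, h⟩
    have hmk : γ.undirected.connectedComponentMk (Γ.r (γ.edge ⟨v, h⟩)) =
        γ.undirected.connectedComponentMk v :=
      γ.connectedComponentMk_endFrom (l := [γ.edge ⟨v, h⟩]) ⟨hs, trivial⟩ (by simpa using hspec)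
    have hE := specialIdempotent_source (F := F) hspec
    rw [hs] at hE
    rw [pushforwardAt_of_nonSink h, ← Finset.add_sum_erase _ _ hmem, edge_mul_componentSum, hmk,
      ite_mul, zero_mul, ← hE, add_sub_cancel_left]
    refine Submodule.sum_mem _ fun e he => ?_
    obtain ⟨hne, he⟩ := Finset.mem_erase.1 he
    have hne' : ¬ γ.IsSpecial e := fun hsp => hne (hsp.eq_edge ⟨v, h⟩ (by simpa using he))
    rw [edge_mul_componentSum]
    split_ifs
    · exact edge_mul_specialIdempotent_mul_ghost_mem_tail hne'
    · rw [zero_mul]; exact zero_mem _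
  · rw [pushforwardAt_of_sink h, vert_mul_componentSum, ite_mul, zero_mul,
      specialIdempotent_mul_vert, sub_self]
    exact zero_mem _

/-! ### Closed ideals and the decomposition of `1` -/

section closedIdeal

variable {S : Set (GradedCompletion F γ)}

theorem isTwoSided_closedIdeal : (closedIdeal S).IsTwoSided := by
  refine ⟨fun {a} b ha => ?_⟩
  rw [closedIdeal, Submodule.mem_sInf] at ha ⊢
  exact fun I hI => hI.1.mul_mem_of_left b (ha I hI)

theorem isClosed_closedIdeal : IsClosed (closedIdeal S : Set (GradedCompletion F γ)) := by
  rw [closedIdeal, Submodule.coe_sInf]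
  exact isClosed_biInter fun I hI => hI.2.1

theorem subset_closedIdeal : S ⊆ closedIdeal S := fun x hx => by
  rw [closedIdeal, SetLike.mem_coe, Submodule.mem_sInf]
  exact fun I hI => hI.2.2 hx

theorem closedIdeal_le {I : Ideal (GradedCompletion F γ)} (h₁ : I.IsTwoSided)
    (h₂ : IsClosed (I : Set (GradedCompletion F γ))) (h₃ : S ⊆ I) : closedIdeal S ≤ I :=
  sInf_le ⟨h₁, h₂, h₃⟩

theorem mul_mul_eq_zero_of_mem_closedIdeal_left {t y : GradedCompletion F γ}
    (h : ∀ s ∈ S, ∀ a, s * a * t = 0) (hy : y ∈ closedIdeal S) (a : GradedCompletion F γ) :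
    y * a * t = 0 := by
  let I : Ideal (GradedCompletion F γ) :=
    { carrier := {y | ∀ a, y * a * t = 0}
      add_mem' := fun hx hy a => by rw [add_mul, add_mul, hx, hy, add_zero]
      zero_mem' := fun a => by rw [zero_mul, zero_mul]
      smul_mem' := fun b x hx a => by
        rw [smul_eq_mul, mul_assoc b, mul_assoc b, hx, mul_zero] }
  refine closedIdeal_le (I := I) ⟨fun {x} b hx a => ?_⟩ ?_ h hy a
  · rw [mul_assoc x]; exact hx _
  · change IsClosed {y | ∀ a, y * a * t = 0}
    simp only [Set.ofPred_forall]
    exact isClosed_iInter fun a => isClosed_singleton.preimage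
      (f := fun y => y * a * t) ((continuous_id.mul continuous_const).mul continuous_const)

theorem mul_mul_eq_zero_of_mem_closedIdeal_right {t y : GradedCompletion F γ}
    (h : ∀ s ∈ S, ∀ a, t * a * s = 0) (hy : y ∈ closedIdeal S) (a : GradedCompletion F γ) :
    t * a * y = 0 := by
  let I : Ideal (GradedCompletion F γ) :=
    { carrier := {y | ∀ a, t * a * y = 0}
      add_mem' := fun hx hy a => by rw [mul_add, hx, hy, add_zero]
      zero_mem' := fun a => by rw [mul_zero]
      smul_mem' := fun b x hx a => by
        rw [smul_eq_mul, ← mul_assoc, mul_assoc t]; exact hx _ }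
  refine closedIdeal_le (I := I) ⟨fun {x} b hx a => ?_⟩ ?_ h hy a
  · rw [← mul_assoc, hx, zero_mul]
  · change IsClosed {y | ∀ a, t * a * y = 0}
    simp only [Set.ofPred_forall]
    exact isClosed_iInter fun a => isClosed_singleton.preimage
      (f := fun y => t * a * y) (continuous_const.mul continuous_id)

end closedIdeal

theorem specialIdempotent_mem_componentIdeal {v : V} {c : γ.undirected.ConnectedComponent}
    (h : γ.undirected.connectedComponentMk v = c) :
    specialIdempotent F γ v ∈ componentIdeal F γ c :=
  subset_closedIdeal ⟨v, h, rfl⟩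

/-- A two-sided ideal containing one of the idempotents of a component contains them all. -/
theorem specialIdempotent_mem_of_connectedComponentMk_eq {I : Ideal (GradedCompletion F γ)}
    (hI : I.IsTwoSided) {v w : V}
    (h : γ.undirected.connectedComponentMk v = γ.undirected.connectedComponentMk w)
    (hv : specialIdempotent F γ v ∈ I) : specialIdempotent F γ w ∈ I := by
  obtain ⟨p⟩ := SimpleGraph.ConnectedComponent.exact h
  induction p with
  | nil => exact hv
  | cons hadj p ih =>
    refine ih (SimpleGraph.ConnectedComponent.sound p.reachable) ?_
    obtain ⟨-, ⟨e, he, rfl, rfl⟩ | ⟨e, he, rfl, rfl⟩⟩ := (SimpleGraph.fromRel_adj _ _ _).1 hadj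
    · rw [specialIdempotent_range he]
      exact hI.mul_mem_of_left _ (I.mul_mem_left _ hv)
    · rw [specialIdempotent_source he]
      exact hI.mul_mem_of_left _ (I.mul_mem_left _ hv)

theorem mul_mul_eq_zero_of_mem_componentIdeal {c d : γ.undirected.ConnectedComponent} (h : c ≠ d)
    {x y : GradedCompletion F γ} (hx : x ∈ componentIdeal F γ c) (hy : y ∈ componentIdeal F γ d)
    (a : GradedCompletion F γ) : x * a * y = 0 := by
  refine mul_mul_eq_zero_of_mem_closedIdeal_right ?_ hy a
  rintro _ ⟨w, hw, rfl⟩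
  refine mul_mul_eq_zero_of_mem_closedIdeal_left ?_ hx
  rintro _ ⟨v, hv, rfl⟩
  refine specialIdempotent_mul_mul_specialIdempotent ?_
  rw [show γ.undirected.connectedComponentMk v = c from hv,
    show γ.undirected.connectedComponentMk w = d from hw]
  exact h

theorem mul_eq_zero_of_mem_componentIdeal {c d : γ.undirected.ConnectedComponent} (h : c ≠ d)
    {x y : GradedCompletion F γ} (hx : x ∈ componentIdeal F γ c) (hy : y ∈ componentIdeal F γ d) :
    x * y = 0 := by
  simpa using mul_mul_eq_zero_of_mem_componentIdeal h hx hy 1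

theorem componentSum_mem (c : γ.undirected.ConnectedComponent) :
    componentSum γ F c ∈ componentIdeal F γ c ∧ componentSum γ F c ∈ component F γ 0 := by
  classical
  constructor
  · exact sum_mem fun v hv => specialIdempotent_mem_componentIdeal (by simpa using hv)
  · exact sum_mem fun v _ => specialIdempotent_mem_component v

/-- The limit of `∑ p e_{r(p)} p^*`, over the paths `p` of length `n` (or shorter and ending in a
sink) which end in the component `c`, exists; it will be the identity element of the ideal
of `c`. -/
theorem exists_tendsto_pushforward (c : γ.undirected.ConnectedComponent) :
    ∃ ε ∈ component F γ 0, ε ∈ componentIdeal F γ c ∧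
      Tendsto (fun n => (pushforward γ F)^[n] (componentSum γ F c)) atTop (𝓝 ε) := by
  have h0 : ∀ n, (pushforward γ F)^[n] (componentSum γ F c) ∈ componentIdeal F γ c ∧
      (pushforward γ F)^[n] (componentSum γ F c) ∈ component F γ 0 := by
    intro n
    induction n with
    | zero => exact componentSum_mem c
    | succ n ih =>
      rw [Function.iterate_succ_apply']
      exact ⟨pushforward_mem
        (fun e => isTwoSided_closedIdeal.mul_mem_of_left _ (Ideal.mul_mem_left _ _ ih.1))
        fun v _ => isTwoSided_closedIdeal.mul_mem_of_left _ (Ideal.mul_mem_left _ _ ih.1),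
        pushforward_mem_component ih.2⟩
  obtain ⟨ε, hε, h⟩ := exists_tendsto (fun n => (h0 n).2) fun n => by
    have := pushforward_iterate_mem_tail (pushforward_componentSum_sub_mem_tail (F := F) c) n
    rw [← Module.End.coe_pow, map_sub, Module.End.coe_pow, ← Function.iterate_succ_apply] at this
    exact this
  exact ⟨ε, hε, isClosed_closedIdeal.mem_of_tendsto h (Eventually.of_forall fun n => (h0 n).1), h⟩

variable (γ) in
/-- The decomposition of `1` along the components of the graph of special edges. -/
theorem exists_sum_eq_one (F : Type*) [Field F] [Fintype γ.undirected.ConnectedComponent] :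
    ∃ ε : γ.undirected.ConnectedComponent → GradedCompletion F γ,
      (∀ c, ε c ∈ component F γ 0) ∧ (∀ c, ε c ∈ componentIdeal F γ c) ∧ ∑ c, ε c = 1 := by
  classical
  choose ε h0 hJ h using exists_tendsto_pushforward (F := F) (γ := γ)
  refine ⟨ε, h0, hJ, ?_⟩
  have hsum : ∑ c, componentSum γ F c = ∑ v, specialIdempotent F γ v :=
    Finset.sum_fiberwise _ _ _
  have h1 := tendsto_finsetSum Finset.univ fun c _ => h c
  have hz : (1 : GradedCompletion F γ) - ∑ c, componentSum γ F c ∈ tail γ F 0 := by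
    rw [hsum, ← sum_vert, ← Finset.sum_sub_distrib]
    exact sum_mem fun v _ => vert_sub_specialIdempotent_mem_tail v
  have h2 := tendsto_zero_of_mem_tail (pushforward_iterate_mem_tail hz)
  have h3 := (h2.const_sub 1)
  rw [sub_zero] at h3
  refine tendsto_nhds_unique h1 (h3.congr fun n => ?_)
  have hone : (pushforward γ F ^ n) 1 = 1 := by
    rw [Module.End.coe_pow]
    exact Function.iterate_fixed pushforward_one n
  rw [← Module.End.coe_pow, map_sub, hone, sub_sub_cancel, map_sum]

theorem mul_mul_eq_zero_of_forall_component {a b : GradedCompletion F γ}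
    (h : ∀ i, ∀ x ∈ component F γ i, a * x * b = 0) (x : GradedCompletion F γ) :
    a * x * b = 0 := by
  have hx : x ∈ ⨆ i, component F γ i := by rw [iSup_component]; trivial
  induction hx using Submodule.iSup_induction' with
  | zero => rw [mul_zero, zero_mul]
  | add x y _ _ hx hy => rw [mul_add, add_mul, hx, hy, add_zero]
  | mem i x hx => exact h i x hx

/-! ### The structure of the ideals `J_c` -/

section decomposition

variable [Fintype γ.undirected.ConnectedComponent]
  {ε : γ.undirected.ConnectedComponent → GradedCompletion F γ}

theorem unit_mul (hJ : ∀ c, ε c ∈ componentIdeal F γ c) (h1 : ∑ c, ε c = 1)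
    {c : γ.undirected.ConnectedComponent} {x : GradedCompletion F γ}
    (hx : x ∈ componentIdeal F γ c) : ε c * x = x := by
  conv_rhs => rw [← one_mul x, ← h1, Finset.sum_mul]
  symm
  refine Finset.sum_eq_single c (fun d _ hd => ?_) fun h => absurd (Finset.mem_univ c) h
  exact mul_eq_zero_of_mem_componentIdeal hd (hJ d) hx

theorem mul_unit (hJ : ∀ c, ε c ∈ componentIdeal F γ c) (h1 : ∑ c, ε c = 1)
    {c : γ.undirected.ConnectedComponent} {x : GradedCompletion F γ}
    (hx : x ∈ componentIdeal F γ c) : x * ε c = x := by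
  conv_rhs => rw [← mul_one x, ← h1, Finset.mul_sum]
  symm
  refine Finset.sum_eq_single c (fun d _ hd => ?_) fun h => absurd (Finset.mem_univ c) h
  exact mul_eq_zero_of_mem_componentIdeal hd.symm hx (hJ d)

theorem iSupIndep_componentIdeal (hJ : ∀ c, ε c ∈ componentIdeal F γ c) (h1 : ∑ c, ε c = 1) :
    iSupIndep (componentIdeal F γ) := by
  intro c
  rw [Submodule.disjoint_def]
  intro x hx hx'
  have hle : ⨆ (d) (_ : d ≠ c), componentIdeal F γ d ≤
      LinearMap.ker (LinearMap.toSpanSingleton (GradedCompletion F γ) _ (ε c)) :=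
    iSup₂_le fun d hd y hy => by
      simpa using mul_eq_zero_of_mem_componentIdeal hd hy (hJ c)
  have h0 : x * ε c = 0 := by simpa using hle hx'
  rw [← mul_unit hJ h1 hx, h0]

theorem iSup_componentIdeal (hJ : ∀ c, ε c ∈ componentIdeal F γ c) (h1 : ∑ c, ε c = 1) :
    ⨆ c, componentIdeal F γ c = ⊤ := by
  rw [Ideal.eq_top_iff_one, ← h1]
  exact sum_mem fun c _ => Submodule.mem_iSup_of_mem c (hJ c)

theorem isGraded_componentIdeal (h0 : ∀ c, ε c ∈ component F γ 0)
    (hJ : ∀ c, ε c ∈ componentIdeal F γ c) (h1 : ∑ c, ε c = 1)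
    (c : γ.undirected.ConnectedComponent) :
    IsGraded ((componentIdeal F γ c).restrictScalars F) := by
  refine le_antisymm ?_ (iSup_le fun i => inf_le_left)
  have key : ∀ x : GradedCompletion F γ,
      ε c * x ∈ ⨆ i, (componentIdeal F γ c).restrictScalars F ⊓ component F γ i := by
    intro x
    have hx : x ∈ ⨆ i, component F γ i := by rw [iSup_component]; trivial
    induction hx using Submodule.iSup_induction' with
    | zero => rw [mul_zero]; exact zero_mem _
    | add a b _ _ ha hb => rw [mul_add]; exact add_mem ha hb
    | mem i a ha =>
      refine Submodule.mem_iSup_of_mem i ⟨isTwoSided_closedIdeal.mul_mem_of_left _ (hJ c), ?_⟩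
      simpa using component_mul γ (h0 c) ha
  intro x hx
  rw [← unit_mul hJ h1 hx]
  exact key x

theorem isTopGradedSimple_componentIdeal (h0 : ∀ c, ε c ∈ component F γ 0)
    (hJ : ∀ c, ε c ∈ componentIdeal F γ c) (h1 : ∑ c, ε c = 1)
    (c : γ.undirected.ConnectedComponent) : IsTopGradedSimple (componentIdeal F γ c) := by
  refine ⟨isGraded_componentIdeal h0 hJ h1 c, ?_, ?_⟩
  · obtain ⟨v, hv⟩ := c.nonempty_supp
    have hm := specialIdempotent_mem_componentIdeal (F := F) hv
    exact ⟨_, hm, _, hm, by rw [specialIdempotent_mul_self]; exact specialIdempotent_ne_zero v⟩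
  · intro K hK hclosed hgraded hideal
    rw [or_iff_not_imp_left]
    intro hne
    refine le_antisymm hK ?_
    have hleft : ∀ a, ∀ x ∈ K, a * x ∈ K := fun a x hx => by
      rw [← unit_mul hJ h1 (hK hx), ← mul_assoc]
      exact (hideal _ ((componentIdeal F γ c).mul_mem_left a (hJ c)) x hx).1
    have hright : ∀ a, ∀ x ∈ K, x * a ∈ K := fun a x hx => by
      rw [← mul_unit hJ h1 (hK hx), mul_assoc]
      exact (hideal _ (isTwoSided_closedIdeal.mul_mem_of_left a (hJ c)) x hx).2
    let I : Ideal (GradedCompletion F γ) :=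
      { carrier := K
        add_mem' := fun hx hy => add_mem hx hy
        zero_mem' := zero_mem K
        smul_mem' := fun a x hx => hleft a x hx }
    have hI : I.IsTwoSided := ⟨fun {x} a hx => hright a x hx⟩
    -- A graded subspace that is not zero contains a nonzero homogeneous element.
    obtain ⟨i, x, hx, hxi, hx0⟩ : ∃ i, ∃ x ∈ K, x ∈ component F γ i ∧ x ≠ 0 := by
      by_contra! hall
      apply hne
      rw [hgraded, iSup_eq_bot]
      exact fun i => (Submodule.eq_bot_iff _).2 fun x hx => hall i x hx.1 hx.2
    -- Otherwise `ε x ε = x` would vanish, since `ε` lies in the closed ideal of the idempotents.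
    obtain ⟨v, hv, w, k, a, ha, l, b, hb, hne⟩ : ∃ v ∈ c.supp, ∃ w, ∃ k, ∃ a ∈ component F γ k,
        ∃ l, ∃ b ∈ component F γ l,
          specialIdempotent F γ v * a * (x * b * specialIdempotent F γ w) ≠ 0 := by
      by_contra! hall
      apply hx0
      have e1 : ∀ w, ∀ l, ∀ b ∈ component F γ l,
          ε c * 1 * (x * b * specialIdempotent F γ w) = 0 := by
        intro w l b hb
        refine mul_mul_eq_zero_of_mem_closedIdeal_left ?_ (hJ c) 1
        rintro _ ⟨v, hv, rfl⟩ a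
        exact mul_mul_eq_zero_of_forall_component (fun k a ha => hall v hv w k a ha l b hb) a
      have e2 : x * 1 * ε c = 0 := by
        refine mul_mul_eq_zero_of_mem_closedIdeal_right ?_ (hJ c) 1
        rintro _ ⟨w, -, rfl⟩ b
        refine mul_mul_eq_zero_of_forall_component (fun l b hb => ?_) b
        rw [← e1 w l b hb, mul_one, mul_assoc x, ← mul_assoc (ε c), unit_mul hJ h1 (hK hx)]
      rw [← mul_unit hJ h1 (hK hx), ← mul_one x, e2]
    have hassoc : specialIdempotent F γ v * a * (x * b * specialIdempotent F γ w) =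
        specialIdempotent F γ v * (a * x * b) * specialIdempotent F γ w := by
      simp only [mul_assoc]
    rw [hassoc] at hne
    obtain ⟨z, hz⟩ := exists_mul_eq_specialIdempotent
      (component_mul γ (component_mul γ ha hxi) hb) hne
    have hvI : specialIdempotent F γ v ∈ I := by
      rw [← hz]
      exact hright _ _ (hright _ _ (hleft _ _ (hright _ _ (hleft _ _ hx))))
    have hle : componentIdeal F γ c ≤ I := by
      refine closedIdeal_le hI hclosed ?_
      rintro _ ⟨u, hu, rfl⟩
      refine specialIdempotent_mem_of_connectedComponentMk_eq hI ?_ hvI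
      rw [show γ.undirected.connectedComponentMk v = c from hv,
        show γ.undirected.connectedComponentMk u = c from hu]
    exact hle

theorem hereditaryIdeal_eq_iSup (hJ : ∀ c, ε c ∈ componentIdeal F γ c) (h1 : ∑ c, ε c = 1)
    {W : Set V} (hW : Γ.IsHereditary W) : hereditaryIdeal F γ W =
      ⨆ c : {c : γ.undirected.ConnectedComponent // (c.supp ∩ W).Nonempty},
        componentIdeal F γ c := by
  apply le_antisymm
  · intro x hx
    rw [← one_mul x, ← h1, Finset.sum_mul]
    refine sum_mem fun c _ => ?_
    by_cases hc : (c.supp ∩ W).Nonempty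
    · exact Submodule.mem_iSup_of_mem (p := fun c : {c : γ.undirected.ConnectedComponent //
        (c.supp ∩ W).Nonempty} => componentIdeal F γ c) ⟨c, hc⟩
        (isTwoSided_closedIdeal.mul_mem_of_left x (hJ c))
    · have hzero : ε c * 1 * x = 0 := by
        refine mul_mul_eq_zero_of_mem_closedIdeal_right ?_ hx 1
        rintro _ ⟨w, hw, rfl⟩
        refine mul_mul_eq_zero_of_mem_closedIdeal_left ?_ (hJ c)
        rintro _ ⟨u, hu, rfl⟩
        refine specialIdempotent_mul_mul_vert hW hw fun v hv hvu => hc ⟨v, ?_, hv⟩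
        exact hvu.trans hu
      rw [mul_one] at hzero
      rw [hzero]
      exact zero_mem _
  · refine iSup_le fun ⟨c, u, hu, huW⟩ =>
      closedIdeal_le isTwoSided_closedIdeal isClosed_closedIdeal ?_
    rintro _ ⟨v, hv, rfl⟩
    refine specialIdempotent_mem_of_connectedComponentMk_eq isTwoSided_closedIdeal
      (hu.trans (Eq.symm hv)) ?_
    rw [← specialIdempotent_mul_vert]
    exact Ideal.mul_mem_left _ _ (subset_closedIdeal ⟨u, huW, rfl⟩)

end decomposition

end GradedCompletion

end DirGraph

end

open DirGraph GradedCompletion in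
theorem proposition1 (F : Type*) [Field F] {V E : Type*} [Fintype V] [Fintype E]
    (Γ : DirGraph V E) (γ : Γ.Specialization) (hγ : γ.Admissible) :
    (∀ v : V, Tendsto (fun n => mon F γ (γ.specialPath v n) (γ.specialPath v n)) atTop
      (𝓝 (specialIdempotent F γ v))) ∧
    (∀ v : V, IsIdempotentElem (specialIdempotent F γ v)) ∧
    (iSupIndep (componentIdeal F γ) ∧ ⨆ c, componentIdeal F γ c = ⊤) ∧
    (∀ c, IsTopGradedSimple (componentIdeal F γ c)) ∧
    ∀ W : Set V, Γ.IsMinHereditary W →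
      iSupIndep (fun c : {c : γ.undirected.ConnectedComponent // (c.supp ∩ W).Nonempty} =>
        componentIdeal F γ c) ∧
      hereditaryIdeal F γ W =
        ⨆ c : {c : γ.undirected.ConnectedComponent // (c.supp ∩ W).Nonempty},
          componentIdeal F γ c := by
  have hfin : Finite γ.undirected.ConnectedComponent :=
    Finite.of_surjective γ.undirected.connectedComponentMk Quot.mk_surjective
  have := Fintype.ofFinite γ.undirected.ConnectedComponent
  obtain ⟨ε, h0, hJ, h1⟩ := exists_sum_eq_one γ F
  have hind := iSupIndep_componentIdeal hJ h1
  exact ⟨tendsto_specialIdempotent, specialIdempotent_mul_self,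
    ⟨hind, iSup_componentIdeal hJ h1⟩, isTopGradedSimple_componentIdeal h0 hJ h1,
    fun W hW => ⟨hind.comp Subtype.val_injective, hereditaryIdeal_eq_iSup hJ h1 hW.1⟩⟩
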